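/- Let $k,m\in\mathbb N$, let $U\subset\mathbb R^m$ be compact and non-empty, and let $(\Omega,\mathcal F,\mathbb P)$ be a probability space. Assume the following. (A.1) $W=(W_t)_{t\in\mathbb N}$ are $\mathbb R^{k+m}$-valued random vectors; $\mathcal F_t=\sigma(W_0,\dots,W_{t-1})$ (so $\mathcal F_0$ is trivial), $W_t$ is independent of $\mathcal F_t$, and all $W_t$ have the same law, i.e. $W$ is i.i.d. (A.2) The factor process satisfies $X_0=x_0\in\mathbb R^k$ and $X_{t+1}=G(X_t,W_t)$, where $G:\mathbb R^k\times\mathbb R^{k+m}\to\mathbb R^k$ is Borel measurable and continuous in its first variable. (A.3) For every $U$-valued $(\mathcal F_t)$-adapted process $H$ the portfolio value satisfies $V^H_0=V_0>0$, $V^H_t>0$ and $\ln (V^H_{t+1}/V^H_t)=F(X_t,H_t,W_t)$, where $F:\mathbb R^k\times U\times\mathbb R^{k+m}\to\mathbb R$ is Borel measurable and (jointly) continuous in its first two variables. (A.4) There are a continuous $\omega:\mathbb R^k\to[0,\infty)$, Borel functions $a_1,a_2:\mathbb R^{k+m}\to[0,\infty)$ and constants $b_1\in(0,1)$, $b_2>0$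 with $$\omega(G(x,w))\le a_1(w)+b_1\omega(x),\qquad |F(x,h,w)|\le a_2(w)+b_2\omega(x)$$ for all $x\in\mathbb R^k$, $h\in U$, $w\in\mathbb R^{k+m}$, and $\mu^\gamma(a_1(W_0)),\mu^\gamma(a_2(W_0))\in\mathbb R$ for every $\gamma\in\mathbb R$, where $\mu^\gamma(Z)=\frac1\gamma\ln\mathbb E[e^{\gamma Z}]$ for $\gamma\ne0$ and $\mu^0(Z)=\mathbb E[Z]$. (A.5) For every $R>0$ there are $c>0$ and a probability measure $\nu$ on $\mathbb R^k$ such that $\mathbb P[G(x,W_0)\in A]\ge c\,\nu(A)$ for all Borel $A\subset\mathbb R^k$ and all $x$ with $\omega(x)\le R$. Let $\mathcal C_\omega(\mathbb R^k)$ be the set of continuous $f:\mathbb R^k\to\mathbb R$ with $\sup_x|f(x)|/(1+\omega(x))<\infty$. For $\beta>0$ put $$\|f\|_{\beta,\omega\text{-span}}=\sup_{x,y}\frac{f(x)-f(y)}{2+\beta\omega(x)+\beta\omega(y)},\qquad \|f\|_{\omega\text{-span}}=\|f\|_{1,\omega\text{-span}},$$ and for $\gamma<0$ put $$T_\gamma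 f(x)=\inf_{h\in U}\ln\mathbb E\big[e^{\gamma F(x,h,W_0)+f(G(x,W_0))}\big].$$ Then there exist $\gamma_0<0$ and functions $\beta,L:[0,\infty)\to(0,1)$ such that for every $\gamma\in(\gamma_0,0)$: (i) $T_\gamma$ maps $\mathcal C_\omega(\mathbb R^k)$ into itself, and it is a local contraction modulo constants: for all $M\ge0$ and all $f_1,f_2\in\mathcal C_\omega(\mathbb R^k)$ with $\|f_1\|_{\omega\text{-span}}\le M$, $\|f_2\|_{\omega\text{-span}}\le M$, $$\|T_\gamma f_1-T_\gamma f_2\|_{\beta(M),\omega\text{-span}}\le L(M)\,\|f_1-f_2\|_{\beta(M),\omega\text{-span}};$$ (ii) there are $u_\gamma\in\mathcal C_\omega(\mathbb R^k)$ and $\lambda_\gamma\in\mathbb R$ solving the Bellman equation $$u_\gamma(x)+\lambda_\gamma\gamma=T_\gamma u_\gamma(x)\qquad\text{for all }x\in\mathbb R^k$$ (that is, $u_\gamma$ is a fixed point of $T_\gamma$ modulo constants), and if $u\in\mathcal C_\omega(\mathbb R^k)$, $\lambda\in\mathbb R$ is any other solution, then $\lambda=\lambda_\gamma$ and $u-u_\gamma$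 is constant. -/

import Mathlib

open MeasureTheory ProbabilityTheory
open scoped NNReal ENNReal

noncomputable section

namespace RiskSensitive

/-- The Euclidean space `ℝⁿ`. -/
abbrev Vec (n : ℕ) : Type := EuclideanSpace ℝ (Fin n)

section Probability

variable {Ω : Type*} [MeasurableSpace Ω]

/-- The `σ`-algebra `𝓕 t` generated by the noise observed strictly before time `t`, that is by
`W 0, …, W (t - 1)`; in particular `𝓕 0` is trivial. -/
@[reducible]
def pastSigma {d : ℕ} (W : ℕ → Ω → Vec d) (t : ℕ) : MeasurableSpace Ω :=
  ⨆ s : ℕ, ⨆ _ : s < t, MeasurableSpace.comap (W s) inferInstance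

/-- The extended-real expectation `E[X⁺] - E[X⁻]`. -/
def extExpectation (P : Measure Ω) (X : Ω → ℝ) : EReal :=
  ((∫⁻ ξ, ENNReal.ofReal (X ξ) ∂P : ℝ≥0∞) : EReal) -
    ((∫⁻ ξ, ENNReal.ofReal (-X ξ) ∂P : ℝ≥0∞) : EReal)

/-- `ln E[e^X]`, as an extended real number (it is `+∞` if `e^X` is not integrable). -/
def logExpMoment (P : Measure Ω) (X : Ω → ℝ) : EReal :=
  ENNReal.log (∫⁻ ξ, ENNReal.ofReal (Real.exp (X ξ)) ∂P)

/-- The entropic utility measure `μ^γ`, with values in the extended real numbers. -/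
def entropicUtility (P : Measure Ω) (γ : ℝ) (X : Ω → ℝ) : EReal :=
  if γ = 0 then extExpectation P X
  else ((1 / γ : ℝ) : EReal) * logExpMoment P (fun ξ => γ * X ξ)

/-- The noise `W` is a sequence of i.i.d. random vectors: `W t` is independent of the past
`𝓕 t = σ(W 0, …, W (t - 1))` and all the `W t` have the same law. -/
structure NoiseAssumption (P : Measure Ω) {d : ℕ} (W : ℕ → Ω → Vec d) : Prop where
  measurable : ∀ t, Measurable (W t)
  indep_past : ∀ t, Indep (MeasurableSpace.comap (W t) inferInstance) (pastSigma W t) P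
  same_law : ∀ t, P.map (W (t + 1)) = P.map (W t)

/-- The factor process starts at a point `x₀` and satisfies `X (t+1) = G (X t, W t)`, with
`G` Borel measurable and continuous in its first variable. (The Markov property of `X` is a
consequence of this and of the independence of the noise.) -/
structure FactorAssumption (P : Measure Ω) {k d : ℕ} (W : ℕ → Ω → Vec d)
    (G : Vec k → Vec d → Vec k) (x₀ : Vec k) (X : ℕ → Ω → Vec k) : Prop where
  measurable_G : Measurable (fun p : Vec k × Vec d => G p.1 p.2)
  continuous_G : ∀ w, Continuous (fun x => G x w)
  init : ∀ᵐ ξ ∂P, X 0 ξ = x₀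
  step : ∀ t, ∀ᵐ ξ ∂P, X (t + 1) ξ = G (X t ξ) (W t ξ)

/-- Admissible strategies: `U`-valued processes adapted to the filtration `𝓕`. -/
def IsAdmissible {m d : ℕ} (W : ℕ → Ω → Vec d) (U : Set (Vec m)) (H : ℕ → Ω → U) : Prop :=
  ∀ t, Measurable[pastSigma W t] (H t)

/-- The value process `V H` of any admissible strategy `H` is positive, starts at `V₀ > 0`
and has the log-returns `F (X t, H t, W t)`, where `F` is Borel measurable and continuous in its
first two variables. -/
structure PortfolioAssumption (P : Measure Ω) {k m d : ℕ} (W : ℕ → Ω → Vec d)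
    (X : ℕ → Ω → Vec k) (U : Set (Vec m)) (F : Vec k → U → Vec d → ℝ) (V₀ : ℝ)
    (V : (ℕ → Ω → U) → ℕ → Ω → ℝ) : Prop where
  measurable_F : Measurable (fun p : Vec k × U × Vec d => F p.1 p.2.1 p.2.2)
  continuous_F : ∀ w, Continuous (fun p : Vec k × U => F p.1 p.2 w)
  V₀_pos : 0 < V₀
  pos : ∀ H, IsAdmissible W U H → ∀ t, ∀ᵐ ξ ∂P, 0 < V H t ξ
  init : ∀ H, IsAdmissible W U H → ∀ᵐ ξ ∂P, V H 0 ξ = V₀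
  step : ∀ H, IsAdmissible W U H → ∀ t, ∀ᵐ ξ ∂P,
    Real.log (V H (t + 1) ξ / V H t ξ) = F (X t ξ) (H t ξ) (W t ξ)

/-- `ω` is a weight function, `G` and `F` have `ω`-growth, and the coefficients `a₁`, `a₂`
evaluated at the noise have finite entropic utility for every risk-aversion parameter. -/
structure GrowthAssumption (P : Measure Ω) {k m d : ℕ} (W : ℕ → Ω → Vec d)
    (G : Vec k → Vec d → Vec k) {U : Set (Vec m)} (F : Vec k → U → Vec d → ℝ)
    (ω : Vec k → ℝ) (a₁ a₂ : Vec d → ℝ) (b₁ b₂ : ℝ) : Prop where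
  continuous_ω : Continuous ω
  nonneg_ω : ∀ x, 0 ≤ ω x
  measurable_a₁ : Measurable a₁
  measurable_a₂ : Measurable a₂
  nonneg_a₁ : ∀ w, 0 ≤ a₁ w
  nonneg_a₂ : ∀ w, 0 ≤ a₂ w
  b₁_mem : b₁ ∈ Set.Ioo (0 : ℝ) 1
  b₂_pos : 0 < b₂
  growth_G : ∀ x w, ω (G x w) ≤ a₁ w + b₁ * ω x
  growth_F : ∀ x h w, |F x h w| ≤ a₂ w + b₂ * ω x
  finite_a₁ : ∀ γ : ℝ, ∃ r : ℝ, entropicUtility P γ (fun ξ => a₁ (W 0 ξ)) = (r : EReal)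
  finite_a₂ : ∀ γ : ℝ, ∃ r : ℝ, entropicUtility P γ (fun ξ => a₂ (W 0 ξ)) = (r : EReal)

/-- Minorization on every sublevel set `C_R = {ω ≤ R}` of the weight function. -/
def MinorizationAssumption (P : Measure Ω) {k d : ℕ} (W : ℕ → Ω → Vec d)
    (G : Vec k → Vec d → Vec k) (ω : Vec k → ℝ) : Prop :=
  ∀ R : ℝ, 0 < R → ∃ c : ℝ, 0 < c ∧ ∃ ν : Measure (Vec k), IsProbabilityMeasure ν ∧
    ∀ A : Set (Vec k), MeasurableSet A → ∀ x : Vec k, ω x ≤ R →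
      ENNReal.ofReal c * ν A ≤ P {ξ | G x (W 0 ξ) ∈ A}

/-- The Bellman operator `T_γ f (x) = inf_{h ∈ U} ln E[exp (γ F(x, h, W₀) + f (G(x, W₀)))]`, with
values in the extended real numbers. -/
def bellmanOp (P : Measure Ω) {k m d : ℕ} (W : ℕ → Ω → Vec d)
    (G : Vec k → Vec d → Vec k) {U : Set (Vec m)} (F : Vec k → U → Vec d → ℝ)
    (γ : ℝ) (f : Vec k → ℝ) (x : Vec k) : EReal :=
  ⨅ h : U, logExpMoment P (fun ξ => γ * F x h (W 0 ξ) + f (G x (W 0 ξ)))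

end Probability

/-- Membership in `C_ω(ℝᵏ)`: `f` is continuous and `sup_x |f x| / (1 + ω x) < ∞`. -/
def MemCω {k : ℕ} (ω : Vec k → ℝ) (f : Vec k → ℝ) : Prop :=
  Continuous f ∧ BddAbove (Set.range fun x => |f x| / (1 + ω x))

/-- The weighted span seminorm
`‖f‖_{β,ω-span} = sup_{x,y} (f x - f y) / (2 + β ω x + β ω y)`. The supremum is finite for every
`f ∈ C_ω(ℝᵏ)` and `β > 0`; the case `β = 1` is the `ω`-span seminorm. -/
def spanSeminorm {k : ℕ} (β : ℝ) (ω : Vec k → ℝ) (f : Vec k → ℝ) : ℝ :=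
  ⨆ p : Vec k × Vec k, (f p.1 - f p.2) / (2 + β * ω p.1 + β * ω p.2)

end RiskSensitive

end

/-! For a fixed state and control, `f ↦ ln E[exp (γ F + f ∘ G)]` is convex, and expectation under
the law tilted by the payoff is a subgradient (`log_integral_exp_sub_le`). Running the minimizer for
`f₂` at `x` and the one for `f₁` at `y` bounds the increment of `T f₁ - T f₂` between `x` and `y` by
a difference of two integrals of the same function `f₁ - f₂` under two tilted transition laws. The
contraction is thus a Harris theorem, in the style of Hairer and Mattingly, for tilted kernels: a
geometric drift of `ω` (`exists_tilted_drift`) and an overlap on sublevel sets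
(`exists_tilted_overlap`) contract the weighted oscillation once `β` is small
(`exists_tilted_contraction`). Drift and minorization survive the tilting uniformly in the controls,
in `|γ| ≤ 1` and in `|f| ≤ K (1 + ω)`; the constants depend on `K`, so the contraction is only
local. Modulo constants, with which `T` commutes, an `ω`-span bound `M` is such a growth bound with
`K = M` (`OscLE.exists_center`).

A local contraction need not preserve any ball. The constants for `M = 1` do not depend on `γ`,
while the oscillation of `T_γ 0` is of order `|γ|`; for small `|γ|` it is at most `1 - L 1`, so the
unit ball of the `β 1`-seminorm is invariant and Picard iteration converges in it
(`exists_bellman_fixedPoint`). Uniqueness is not confined to that ball: any two solutions share some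
bound `M`, and the contraction for that `M` makes their difference constant. -/

namespace RiskSensitive

open Filter Topology Real

/-! ### Exponential moments and the entropic functional. -/

section ExponentialMoments

variable {Ω : Type*} [MeasurableSpace Ω] {P : Measure Ω} {a : Ω → ℝ}

lemma integrable_of_abs_le_mul_exp (hexp : ∀ s : ℝ, Integrable (fun ξ => exp (s * a ξ)) P)
    {g : Ω → ℝ} (hg : Measurable g) {C s : ℝ} (h : ∀ ξ, |g ξ| ≤ C * exp (s * a ξ)) :
    Integrable g P :=
  ((hexp s).const_mul C).mono' hg.aestronglyMeasurable (ae_of_all _ h)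

lemma integrable_exp_of_le (hexp : ∀ s : ℝ, Integrable (fun ξ => exp (s * a ξ)) P)
    {Z : Ω → ℝ} (hZ : Measurable Z) {s c : ℝ} (h : ∀ ξ, Z ξ ≤ s * a ξ + c) :
    Integrable (fun ξ => exp (Z ξ)) P := by
  refine integrable_of_abs_le_mul_exp hexp (C := exp c) (s := s) (by fun_prop) fun ξ => ?_
  rw [abs_of_pos (exp_pos _), ← exp_add]
  exact exp_le_exp.2 (by linarith [h ξ])

lemma integrable_of_abs_le (hexp : ∀ s : ℝ, Integrable (fun ξ => exp (s * a ξ)) P)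
    (ha : ∀ ξ, 0 ≤ a ξ) {Z : Ω → ℝ} (hZ : Measurable Z) {s c : ℝ} (hs : 0 ≤ s)
    (h : ∀ ξ, |Z ξ| ≤ s * a ξ + c) : Integrable Z P := by
  refine integrable_of_abs_le_mul_exp hexp (C := s + |c|) (s := 1) hZ fun ξ => ?_
  have h1 := add_one_le_exp (1 * a ξ)
  have h2 : (1 : ℝ) ≤ exp (1 * a ξ) := by linarith [ha ξ]
  calc |Z ξ| ≤ s * a ξ + c := h ξ
    _ ≤ s * exp (1 * a ξ) + |c| * exp (1 * a ξ) := by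
        gcongr
        · linarith
        · nlinarith [abs_nonneg c, le_abs_self c]
    _ = _ := by ring

lemma integrable_tilted_of_abs_le (hexp : ∀ s : ℝ, Integrable (fun ξ => exp (s * a ξ)) P)
    (ha : ∀ ξ, 0 ≤ a ξ)
    {Z : Ω → ℝ} (hZ : Measurable Z) {s c : ℝ} (h : ∀ ξ, Z ξ ≤ s * a ξ + c)
    {g : Ω → ℝ} (hg : Measurable g) {s' c' : ℝ} (hs' : 0 ≤ s')
    (h' : ∀ ξ, |g ξ| ≤ s' * a ξ + c') : Integrable g (P.tilted Z) := by
  rw [integrable_tilted_iff (integrable_exp_of_le hexp hZ h)]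
  refine integrable_of_abs_le_mul_exp hexp (C := exp c * (s' + |c'|)) (s := s + 1)
    (by fun_prop) fun ξ => ?_
  rw [smul_eq_mul, abs_mul, abs_of_pos (exp_pos _)]
  have h1 := add_one_le_exp (a ξ)
  have h2 : (1 : ℝ) ≤ exp (a ξ) := by linarith [ha ξ]
  have h3 : |g ξ| ≤ (s' + |c'|) * exp (a ξ) := by
    calc |g ξ| ≤ s' * a ξ + c' := h' ξ
      _ ≤ s' * exp (a ξ) + |c'| * exp (a ξ) := by
        gcongr
        · linarith
        · nlinarith [abs_nonneg c', le_abs_self c']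
      _ = _ := by ring
  calc exp (Z ξ) * |g ξ| ≤ exp (s * a ξ + c) * ((s' + |c'|) * exp (a ξ)) := by
        gcongr
        exact h ξ
    _ = _ := by rw [add_mul s 1, one_mul, exp_add, exp_add]; ring

/-- Jensen's inequality for the exponential function. -/
lemma integral_le_log_integral_exp [IsProbabilityMeasure P] {Z : Ω → ℝ} (hZ : Integrable Z P)
    (hZe : Integrable (fun ξ => exp (Z ξ)) P) : ∫ ξ, Z ξ ∂P ≤ log (∫ ξ, exp (Z ξ) ∂P) := by
  rw [le_log_iff_exp_le (integral_exp_pos hZe)]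
  exact convexOn_exp.map_integral_le continuous_exp.continuousOn isClosed_univ
    (ae_of_all _ fun _ => Set.mem_univ _) hZ hZe

lemma log_integral_exp_mono [IsProbabilityMeasure P] {Z Z' : Ω → ℝ} (h : ∀ ξ, Z ξ ≤ Z' ξ)
    (hZ : Integrable (fun ξ => exp (Z ξ)) P)
    (hZ' : Integrable (fun ξ => exp (Z' ξ)) P) :
    log (∫ ξ, exp (Z ξ) ∂P) ≤ log (∫ ξ, exp (Z' ξ) ∂P) :=
  log_le_log (integral_exp_pos hZ) (integral_mono hZ hZ' fun ξ => exp_le_exp.2 (h ξ))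

lemma log_integral_exp_add_const [IsProbabilityMeasure P] {Z : Ω → ℝ}
    (hZ : Integrable (fun ξ => exp (Z ξ)) P) (c : ℝ) :
    log (∫ ξ, exp (Z ξ + c) ∂P) = log (∫ ξ, exp (Z ξ) ∂P) + c := by
  simp_rw [exp_add]
  rw [integral_mul_const, log_mul (integral_exp_pos hZ).ne' (exp_pos c).ne', log_exp]

lemma log_integral_exp_le [IsProbabilityMeasure P]
    (hexp : ∀ s : ℝ, Integrable (fun ξ => exp (s * a ξ)) P)
    {Z : Ω → ℝ} (hZ : Measurable Z) {s c : ℝ} (h : ∀ ξ, Z ξ ≤ s * a ξ + c) :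
    log (∫ ξ, exp (Z ξ) ∂P) ≤ cgf a P s + c := by
  rw [cgf, mgf, ← log_integral_exp_add_const (hexp s)]
  refine log_integral_exp_mono h (integrable_exp_of_le hexp hZ h) ?_
  simpa only [exp_add] using (hexp s).mul_const _

/-- Jensen is used twice, once for `-(s * a + c)` and once to replace the mean of `s * a` by `cgf a
P s`, so that upper and lower bounds carry the same constant. -/
lemma neg_le_log_integral_exp [IsProbabilityMeasure P]
    (hexp : ∀ s : ℝ, Integrable (fun ξ => exp (s * a ξ)) P) (hm : Measurable a)
    (ha : ∀ ξ, 0 ≤ a ξ) {Z : Ω → ℝ}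
    (hZe : Integrable (fun ξ => exp (Z ξ)) P) {s c : ℝ} (hs : 0 ≤ s)
    (h : ∀ ξ, -(s * a ξ + c) ≤ Z ξ) :
    -(cgf a P s + c) ≤ log (∫ ξ, exp (Z ξ) ∂P) := by
  have hi : Integrable (fun ξ => s * a ξ) P :=
    integrable_of_abs_le hexp ha (s := s) (c := 0) (by fun_prop) hs fun ξ => by
      rw [abs_of_nonneg (mul_nonneg hs (ha ξ)), add_zero]
  have hi' : Integrable (fun ξ => -(s * a ξ + c)) P := (hi.add (integrable_const c)).neg
  have he : Integrable (fun ξ => exp (-(s * a ξ + c))) P :=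
    integrable_exp_of_le hexp (s := -s) (c := -c) (by fun_prop) fun ξ => by linarith
  calc -(cgf a P s + c) ≤ -(∫ ξ, s * a ξ ∂P + c) := by
        gcongr
        exact integral_le_log_integral_exp hi (hexp s)
    _ = ∫ ξ, -(s * a ξ + c) ∂P := by
        rw [integral_neg, integral_add hi (integrable_const c)]; simp
    _ ≤ log (∫ ξ, exp (-(s * a ξ + c)) ∂P) := integral_le_log_integral_exp hi' he
    _ ≤ _ := log_integral_exp_mono h he hZe

/-- The entropic functional has the tilted measure as a subgradient. -/
lemma log_integral_exp_sub_le [IsProbabilityMeasure P] {Z₁ Z₂ : Ω → ℝ}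
    (h₁ : Integrable (fun ξ => exp (Z₁ ξ)) P) (h₂ : Integrable (fun ξ => exp (Z₂ ξ)) P)
    (hd : Integrable (fun ξ => Z₂ ξ - Z₁ ξ) (P.tilted Z₁)) :
    log (∫ ξ, exp (Z₁ ξ) ∂P) - log (∫ ξ, exp (Z₂ ξ) ∂P) ≤
      -∫ ξ, (Z₂ ξ - Z₁ ξ) ∂(P.tilted Z₁) := by
  have := isProbabilityMeasure_tilted h₁
  have hsum : ∀ ξ, (Z₁ + fun ξ => Z₂ ξ - Z₁ ξ) ξ = Z₂ ξ := fun ξ => by simp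
  have hde : Integrable (fun ξ => exp (Z₂ ξ - Z₁ ξ)) (P.tilted Z₁) := by
    rw [integrable_tilted_iff h₁]
    refine h₂.congr (ae_of_all _ fun ξ => ?_)
    simp only [smul_eq_mul]
    rw [← exp_add]; congr 1; ring
  have key := integral_le_log_integral_exp hd hde
  rw [integral_exp_tilted] at key
  simp_rw [hsum] at key
  rw [log_div (integral_exp_pos h₂).ne' (integral_exp_pos h₁).ne'] at key
  linarith

end ExponentialMoments

/-! ### Drift and minorization for the tilted transitions. -/

section Model

variable {Ω E A : Type*} [MeasurableSpace Ω] [TopologicalSpace E]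
  [MeasurableSpace E] [TopologicalSpace A]

/-- A one-step controlled transition `x ↦ G x ξ` with running reward `F x h ξ` whose growth is
controlled by the weight `ω` and by a random variable `a` with exponential moments of all orders,
and which satisfies a minorization condition on the sublevel sets of `ω`. -/
structure ControlledModel (P : Measure Ω) (G : E → Ω → E) (F : E → A → Ω → ℝ) (ω : E → ℝ)
    (a : Ω → ℝ) (b₁ b₂ : ℝ) : Prop where
  measurable_G : ∀ x, Measurable (G x)
  measurable_F : ∀ x h, Measurable (F x h)
  continuous_G : ∀ ξ, Continuous fun x => G x ξ
  continuous_F : ∀ ξ, Continuous fun p : E × A => F p.1 p.2 ξ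
  continuous_ω : Continuous ω
  nonneg_ω : ∀ x, 0 ≤ ω x
  measurable_a : Measurable a
  nonneg_a : ∀ ξ, 0 ≤ a ξ
  integrable_exp : ∀ s : ℝ, Integrable (fun ξ => exp (s * a ξ)) P
  b₁_mem : b₁ ∈ Set.Ioo (0 : ℝ) 1
  b₂_pos : 0 < b₂
  growth_G : ∀ x ξ, ω (G x ξ) ≤ a ξ + b₁ * ω x
  growth_F : ∀ x h ξ, |F x h ξ| ≤ a ξ + b₂ * ω x
  minorization : ∀ R : ℝ, 0 < R → ∃ c : ℝ, 0 < c ∧ ∃ ν : Measure E, IsProbabilityMeasure ν ∧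
    ∀ x, ω x ≤ R → ENNReal.ofReal c • ν ≤ P.map (G x)

/-- The exponent `γ F(x, h, ·) + f(G(x, ·))`. -/
def payoff (G : E → Ω → E) (F : E → A → Ω → ℝ) (γ : ℝ) (f : E → ℝ) (x : E) (h : A) (ξ : Ω) : ℝ :=
  γ * F x h ξ + f (G x ξ)

variable {P : Measure Ω} {G : E → Ω → E} {F : E → A → Ω → ℝ} {ω : E → ℝ} {a : Ω → ℝ} {b₁ b₂ : ℝ}

namespace ControlledModel

variable (S : ControlledModel P G F ω a b₁ b₂)
include S

lemma abs_comp_le {f : E → ℝ} {K : ℝ} (hK : 0 ≤ K) (hf : ∀ z, |f z| ≤ K * (1 + ω z)) (x : E)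
    (ξ : Ω) : |f (G x ξ)| ≤ K * a ξ + K * (1 + ω x) := by
  have h1 := S.growth_G x ξ
  have h2 := S.b₁_mem.2
  have h3 := S.nonneg_ω x
  calc |f (G x ξ)| ≤ K * (1 + ω (G x ξ)) := hf _
    _ ≤ K * (1 + (a ξ + 1 * ω x)) := by
        gcongr
        exact h1.trans (by gcongr)
    _ = _ := by ring

lemma abs_payoff_le {γ K : ℝ} (hγ : |γ| ≤ 1) (hK : 0 ≤ K) {f : E → ℝ}
    (hf : ∀ z, |f z| ≤ K * (1 + ω z)) (x : E) (h : A) (ξ : Ω) :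
    |payoff G F γ f x h ξ| ≤ (1 + K) * a ξ + (K + (b₂ + K) * ω x) := by
  have h1 := S.abs_comp_le hK hf x ξ
  have h2 : |γ * F x h ξ| ≤ 1 * (a ξ + b₂ * ω x) := by
    rw [abs_mul]
    exact mul_le_mul hγ (S.growth_F x h ξ) (abs_nonneg _) zero_le_one
  calc |payoff G F γ f x h ξ| ≤ |γ * F x h ξ| + |f (G x ξ)| := abs_add_le _ _
    _ ≤ _ := by linarith

lemma measurable_payoff {f : E → ℝ} (hf : Measurable f) (γ : ℝ) (x : E) (h : A) :
    Measurable (payoff G F γ f x h) :=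
  ((S.measurable_F x h).const_mul γ).add (hf.comp (S.measurable_G x))

lemma integrable_exp_payoff {γ K : ℝ} (hγ : |γ| ≤ 1) (hK : 0 ≤ K) {f : E → ℝ} (hf : Measurable f)
    (hfK : ∀ z, |f z| ≤ K * (1 + ω z)) (x : E) (h : A) :
    Integrable (fun ξ => exp (payoff G F γ f x h ξ)) P :=
  integrable_exp_of_le S.integrable_exp (S.measurable_payoff hf γ x h)
    fun ξ => (le_abs_self _).trans (S.abs_payoff_le hγ hK hfK x h ξ)

lemma integrable_comp_tilted {γ K : ℝ} (hγ : |γ| ≤ 1) (hK : 0 ≤ K) {f : E → ℝ} (hf : Measurable f)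
    (hfK : ∀ z, |f z| ≤ K * (1 + ω z)) {φ : E → ℝ} (hφ : Measurable φ) {B : ℝ} (hB : 0 ≤ B)
    (hφB : ∀ z, |φ z| ≤ B * (1 + ω z)) (x : E) (h : A) :
    Integrable (fun ξ => φ (G x ξ)) (P.tilted (payoff G F γ f x h)) :=
  integrable_tilted_of_abs_le S.integrable_exp S.nonneg_a (S.measurable_payoff hf γ x h)
    (fun ξ => (le_abs_self _).trans (S.abs_payoff_le hγ hK hfK x h ξ))
    (hφ.comp (S.measurable_G x)) hB (S.abs_comp_le hB hφB x)

variable [IsProbabilityMeasure P]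

lemma isProbabilityMeasure_tilted_payoff {γ K : ℝ} (hγ : |γ| ≤ 1) (hK : 0 ≤ K) {f : E → ℝ}
    (hf : Measurable f) (hfK : ∀ z, |f z| ≤ K * (1 + ω z)) (x : E) (h : A) :
    IsProbabilityMeasure (P.tilted (payoff G F γ f x h)) :=
  isProbabilityMeasure_tilted (S.integrable_exp_payoff hγ hK hf hfK x h)

lemma cgf_nonneg {s : ℝ} (hs : 0 ≤ s) : 0 ≤ cgf a P s := by
  have h := log_integral_exp_le (P := P) (Z := fun _ => (0 : ℝ)) (s := s) (c := 0)
    S.integrable_exp measurable_const fun ξ => by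
      have := mul_nonneg hs (S.nonneg_a ξ)
      linarith
  simpa using h

lemma abs_log_integral_exp_payoff_le {γ K : ℝ} (hγ : |γ| ≤ 1) (hK : 0 ≤ K) {f : E → ℝ}
    (hf : Measurable f) (hfK : ∀ z, |f z| ≤ K * (1 + ω z)) (x : E) (h : A) :
    |log (∫ ξ, exp (payoff G F γ f x h ξ) ∂P)| ≤
      cgf a P (1 + K) + (K + (b₂ + K) * ω x) := by
  have hb := S.abs_payoff_le hγ hK hfK x h
  rw [abs_le]
  exact ⟨neg_le_log_integral_exp S.integrable_exp S.measurable_a S.nonneg_a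
      (S.integrable_exp_payoff hγ hK hf hfK x h) (by positivity) fun ξ => (abs_le.1 (hb ξ)).1,
    log_integral_exp_le S.integrable_exp (S.measurable_payoff hf γ x h)
      fun ξ => (abs_le.1 (hb ξ)).2⟩

/-- The tilted transition satisfies a geometric drift condition. -/
lemma exists_tilted_drift [BorelSpace E] {K : ℝ} (hK : 0 ≤ K) :
    ∃ C : ℝ, 0 ≤ C ∧ ∀ (γ : ℝ) (f : E → ℝ), |γ| ≤ 1 → Measurable f →
      (∀ z, |f z| ≤ K * (1 + ω z)) → ∀ (x : E) (h : A),
      ∫ ξ, ω (G x ξ) ∂(P.tilted (payoff G F γ f x h)) ≤ (1 + b₁) / 2 * ω x + C := by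
  obtain ⟨hb0, hb1⟩ := S.b₁_mem
  have hb2 := S.b₂_pos
  -- Chosen so that tilting costs only `(1 - b₁) / 2 * ω x`, half of the available drift.
  set θ : ℝ := 4 * (b₂ + K) / (1 - b₁) with hθ
  have hθ0 : 0 < θ := by
    have : 0 < 1 - b₁ := by linarith
    positivity
  have hcgf1 := S.cgf_nonneg (s := 1 + K + θ) (by positivity)
  have hcgf2 := S.cgf_nonneg (s := 1 + K) (by positivity)
  refine ⟨(cgf a P (1 + K + θ) + cgf a P (1 + K) + 2 * K) / θ, by positivity, ?_⟩
  intro γ f hγ hf hfK x h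
  have hZ := S.measurable_payoff hf γ x h
  have hb := S.abs_payoff_le hγ hK hfK x h
  have hZe := S.integrable_exp_payoff hγ hK hf hfK x h
  have := isProbabilityMeasure_tilted hZe
  have hia : Integrable a (P.tilted (payoff G F γ f x h)) :=
    integrable_tilted_of_abs_le S.integrable_exp S.nonneg_a hZ
      (fun ξ => (abs_le.1 (hb ξ)).2) S.measurable_a (s' := 1) (c' := 0) zero_le_one fun ξ => by
        rw [abs_of_nonneg (S.nonneg_a ξ)]; linarith
  have hle : ∀ ξ, payoff G F γ f x h ξ + θ * a ξ ≤
      (1 + K + θ) * a ξ + (K + (b₂ + K) * ω x) := fun ξ => by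
    linarith [(abs_le.1 (hb ξ)).2]
  have hZa : Measurable fun ξ => payoff G F γ f x h ξ + θ * a ξ :=
    hZ.add (S.measurable_a.const_mul θ)
  -- Perturbing the payoff by `θ * a` bounds `θ` times the tilted mean of `a` by a difference of two
  -- log-moments, each growing at most linearly in `ω x`.
  have h1 := log_integral_exp_sub_le hZe (integrable_exp_of_le S.integrable_exp hZa hle)
    (by simpa using hia.const_mul θ)
  simp only [add_sub_cancel_left, integral_const_mul] at h1
  have h2 := log_integral_exp_le S.integrable_exp hZa hle
  have h3 := (abs_le.1 (S.abs_log_integral_exp_payoff_le hγ hK hf hfK x h)).1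
  have hωi : Integrable (fun ξ => ω (G x ξ)) (P.tilted (payoff G F γ f x h)) :=
    S.integrable_comp_tilted hγ hK hf hfK S.continuous_ω.measurable (B := 1) zero_le_one
      (fun z => by rw [abs_of_nonneg (S.nonneg_ω z)]; linarith) x h
  have h4 : ∫ ξ, ω (G x ξ) ∂(P.tilted (payoff G F γ f x h)) ≤
      ∫ ξ, a ξ ∂(P.tilted (payoff G F γ f x h)) + b₁ * ω x := by
    calc _ ≤ ∫ ξ, (a ξ + b₁ * ω x) ∂(P.tilted (payoff G F γ f x h)) :=
          integral_mono hωi (hia.add (integrable_const _)) (S.growth_G x)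
      _ = _ := by rw [integral_add hia (integrable_const _)]; simp
  set I := ∫ ξ, a ξ ∂(P.tilted (payoff G F γ f x h))
  have h5 : I ≤ (cgf a P (1 + K + θ) + cgf a P (1 + K) + 2 * K) / θ
      + 2 * (b₂ + K) / θ * ω x := by
    rw [div_mul_eq_mul_div, ← add_div, le_div_iff₀ hθ0]
    linarith
  have h6 : 2 * (b₂ + K) / θ = (1 - b₁) / 2 := by
    rw [hθ]
    have : 1 - b₁ ≠ 0 := by linarith
    have : b₂ + K ≠ 0 := by positivity
    field_simp
    norm_num
  rw [h6] at h5
  linarith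

/-- The tilted transition inherits a uniform overlap from the minorization condition. -/
lemma exists_tilted_overlap {K R : ℝ} (hK : 0 ≤ K) (hR : 0 < R) :
    ∃ α : ℝ, 0 < α ∧ ∀ (γ : ℝ) (f₁ f₂ : E → ℝ), |γ| ≤ 1 → Measurable f₁ → Measurable f₂ →
      (∀ z, |f₁ z| ≤ K * (1 + ω z)) → (∀ z, |f₂ z| ≤ K * (1 + ω z)) →
      ∀ (x y : E) (h₁ h₂ : A), ω x ≤ R → ω y ≤ R →
      ∀ (ψ₁ ψ₂ : E → ℝ) (B D : ℝ), Measurable ψ₁ → Measurable ψ₂ → 0 ≤ B → 0 ≤ D →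
        (∀ z, 0 ≤ ψ₁ z) → (∀ z, 0 ≤ ψ₂ z) → (∀ z, |ψ₁ z| ≤ B * (1 + ω z)) →
        (∀ z, |ψ₂ z| ≤ B * (1 + ω z)) → (∀ z, 2 * D ≤ ψ₁ z + ψ₂ z) →
        α * D ≤ ∫ ξ, ψ₁ (G x ξ) ∂(P.tilted (payoff G F γ f₁ x h₁)) +
          ∫ ξ, ψ₂ (G y ξ) ∂(P.tilted (payoff G F γ f₂ y h₂)) := by
  obtain ⟨c, hc, ν, hν, hmin⟩ := S.minorization R hR
  have hb2 := S.b₂_pos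
  have hai : Integrable a P := integrable_of_abs_le S.integrable_exp S.nonneg_a S.measurable_a
    (s := 1) (c := 0) zero_le_one fun ξ => by rw [abs_of_nonneg (S.nonneg_a ξ)]; linarith
  have ha0 : 0 ≤ ∫ ξ, a ξ ∂P := integral_nonneg S.nonneg_a
  -- By Markov, `{a > N}` has probability at most `c / 4`; on its complement, for `ω x ≤ R`, the
  -- tilting density is at least the `q` below.
  set N : ℝ := 4 * (∫ ξ, a ξ ∂P + 1) / c with hN
  have hN0 : 0 < N := by positivity
  set q : ℝ := exp (-((1 + K) * N + cgf a P (1 + K) + 2 * (K + (b₂ + K) * R))) with hq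
  have hq0 : 0 < q := exp_pos _
  have hNc : 2 * ∫ ξ, a ξ / N ∂P ≤ c / 2 := by
    rw [integral_div, hN, ← mul_div_assoc, div_le_iff₀ (by positivity)]
    field_simp
    linarith
  have single : ∀ (γ : ℝ) (f : E → ℝ), |γ| ≤ 1 → Measurable f →
      (∀ z, |f z| ≤ K * (1 + ω z)) → ∀ (x : E) (h : A), ω x ≤ R →
      ∀ (ψ : E → ℝ) (B D : ℝ), Measurable ψ → 0 ≤ B → 0 ≤ D → (∀ z, 0 ≤ ψ z) →
        (∀ z, |ψ z| ≤ B * (1 + ω z)) →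
        q * (c * ∫ z, min (ψ z) (2 * D) ∂ν - c / 2 * D) ≤
          ∫ ξ, ψ (G x ξ) ∂(P.tilted (payoff G F γ f x h)) := by
    intro γ f hγ hf hfK x h hx ψ B D hψ hB hD hψ0 hψB
    -- Truncation bounds what is lost where `a` is large by a multiple of `D`, and does not destroy
    -- the lower bound `2 * D` on the sum of the two functions.
    set p : E → ℝ := fun z => min (ψ z) (2 * D) with hp
    have hpm : Measurable p := hψ.min measurable_const
    have hp0 : ∀ z, 0 ≤ p z := fun z => le_min (hψ0 z) (by positivity)
    have hp2 : ∀ z, p z ≤ 2 * D := fun z => min_le_right _ _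
    have hpψ : ∀ z, p z ≤ ψ z := fun z => min_le_left _ _
    have hpB : ∀ z, |p z| ≤ B * (1 + ω z) := fun z => by
      rw [abs_of_nonneg (hp0 z)]
      exact (hpψ z).trans ((le_abs_self _).trans (hψB z))
    have hpi : ∀ (μ : Measure E) [IsFiniteMeasure μ], Integrable p μ := fun μ _ =>
      Integrable.of_bound hpm.aestronglyMeasurable (2 * D) (ae_of_all _ fun z => by
        rw [norm_eq_abs, abs_of_nonneg (hp0 z)]; exact hp2 z)
    have hpGi : Integrable (fun ξ => p (G x ξ)) P :=
      Integrable.of_bound (hpm.comp (S.measurable_G x)).aestronglyMeasurable (2 * D)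
        (ae_of_all _ fun z => by rw [norm_eq_abs, abs_of_nonneg (hp0 _)]; exact hp2 _)
    have hZe := S.integrable_exp_payoff hγ hK hf hfK x h
    have hJ := integral_exp_pos hZe
    have hpQ := S.integrable_comp_tilted hγ hK hf hfK hpm hB hpB x h
    have hψQ := S.integrable_comp_tilted hγ hK hf hfK hψ hB hψB x h
    have h1 : c * ∫ z, p z ∂ν ≤ ∫ ξ, p (G x ξ) ∂P := by
      have := S.measurable_G x
      have hprob : IsProbabilityMeasure (P.map (G x)) :=
        Measure.isProbabilityMeasure_map this.aemeasurable
      have h' := integral_mono_measure (hmin x hx) (ae_of_all _ hp0) (hpi _)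
      rw [integral_smul_measure, ENNReal.toReal_ofReal hc.le,
        integral_map this.aemeasurable hpm.aestronglyMeasurable] at h'
      exact h'
    -- The affine function `1 - a / N` replaces the indicator of `{a ≤ N}`: it is at most `1`, and
    -- negative where `a > N`.
    have hdens : ∀ ξ, q * (1 - a ξ / N) ≤
        exp (payoff G F γ f x h ξ) / ∫ ξ, exp (payoff G F γ f x h ξ) ∂P := by
      intro ξ
      rcases le_or_gt (a ξ) N with haN | haN
      · have e1 : q * (1 - a ξ / N) ≤ q := by
          have : 0 ≤ a ξ / N := div_nonneg (S.nonneg_a ξ) hN0.le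
          nlinarith
        refine e1.trans ?_
        rw [← exp_log hJ, ← exp_sub, hq, exp_le_exp]
        have e2 := (abs_le.1 (S.abs_payoff_le hγ hK hfK x h ξ)).1
        have e3 := (abs_le.1 (S.abs_log_integral_exp_payoff_le hγ hK hf hfK x h)).2
        have e4 : (1 + K) * a ξ ≤ (1 + K) * N := by gcongr
        have e5 : (b₂ + K) * ω x ≤ (b₂ + K) * R := by gcongr
        linarith
      · have e1 : 1 - a ξ / N ≤ 0 := by
          rw [sub_nonpos, le_div_iff₀ hN0]; linarith
        exact (mul_nonpos_of_nonneg_of_nonpos hq0.le e1).trans (by positivity)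
    have h2 : q * (∫ ξ, p (G x ξ) ∂P - 2 * D * ∫ ξ, a ξ / N ∂P) ≤
        ∫ ξ, p (G x ξ) ∂(P.tilted (payoff G F γ f x h)) := by
      rw [integral_tilted, ← integral_const_mul, ← integral_sub hpGi
        ((hai.div_const N).const_mul _), ← integral_const_mul]
      refine integral_mono ((hpGi.sub ((hai.div_const N).const_mul _)).const_mul q) ?_ fun ξ => ?_
      · exact (integrable_tilted_iff hZe _).1 hpQ |>.div_const
          (∫ ξ, exp (payoff G F γ f x h ξ) ∂P) |>.congr
          (ae_of_all _ fun ξ => by simp only [smul_eq_mul]; ring)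
      · simp only [smul_eq_mul]
        have e1 := mul_le_mul_of_nonneg_right (hdens ξ) (hp0 (G x ξ))
        have e2 : 0 ≤ q * (a ξ / N) := mul_nonneg hq0.le (div_nonneg (S.nonneg_a ξ) hN0.le)
        have e3 := mul_le_mul_of_nonneg_left (hp2 (G x ξ)) e2
        linarith
    have h3 := integral_mono hpQ hψQ fun ξ => hpψ (G x ξ)
    refine le_trans ?_ (h2.trans h3)
    have h4 := mul_le_mul_of_nonneg_right hNc hD
    refine mul_le_mul_of_nonneg_left ?_ hq0.le
    linarith
  -- The two minorizations give `2 * q * c * D` in total, and each loses `q * c / 2 * D`.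
  refine ⟨q * c, by positivity, ?_⟩
  intro γ f₁ f₂ hγ hf₁ hf₂ hfK₁ hfK₂ x y h₁ h₂ hx hy ψ₁ ψ₂ B D hψ₁ hψ₂ hB hD hψ₁0 hψ₂0 hψB₁ hψB₂ hsum
  have s1 := single γ f₁ hγ hf₁ hfK₁ x h₁ hx ψ₁ B D hψ₁ hB hD hψ₁0 hψB₁
  have s2 := single γ f₂ hγ hf₂ hfK₂ y h₂ hy ψ₂ B D hψ₂ hB hD hψ₂0 hψB₂
  have hpi : ∀ ψ : E → ℝ, Measurable ψ → (∀ z, 0 ≤ ψ z) →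
      Integrable (fun z => min (ψ z) (2 * D)) ν := fun ψ hψ hψ0 =>
    Integrable.of_bound (hψ.min measurable_const).aestronglyMeasurable (2 * D)
      (ae_of_all _ fun z => by
        rw [norm_eq_abs, abs_of_nonneg (le_min (hψ0 z) (by positivity))]; exact min_le_right _ _)
  have hν2 : 2 * D ≤ ∫ z, min (ψ₁ z) (2 * D) ∂ν + ∫ z, min (ψ₂ z) (2 * D) ∂ν := by
    rw [← integral_add (hpi ψ₁ hψ₁ hψ₁0) (hpi ψ₂ hψ₂ hψ₂0)]
    calc 2 * D = ∫ _, 2 * D ∂ν := by simp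
      _ ≤ _ := integral_mono (integrable_const _) ((hpi ψ₁ hψ₁ hψ₁0).add (hpi ψ₂ hψ₂ hψ₂0))
        fun z => by
          have := hsum z
          have := hψ₁0 z
          have := hψ₂0 z
          simp only [Pi.add_apply]
          rcases min_cases (ψ₁ z) (2 * D) with h | h <;> rcases min_cases (ψ₂ z) (2 * D) with h' | h' <;>
            linarith
  have := mul_le_mul_of_nonneg_left hν2 (mul_pos hq0 hc).le
  linarith

end ControlledModel

end Model

/-! ### Harris contraction and the Bellman operator. -/

section Bellman

variable {Ω E A : Type*} [MeasurableSpace Ω] [TopologicalSpace E] [MeasurableSpace E]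
  [TopologicalSpace A]
  {P : Measure Ω} {G : E → Ω → E} {F : E → A → Ω → ℝ} {ω : E → ℝ} {a : Ω → ℝ} {b₁ b₂ : ℝ}

/-- The Bellman operator `T_γ`, with real values. -/
noncomputable def bellmanValue (P : Measure Ω) (G : E → Ω → E) (F : E → A → Ω → ℝ) (γ : ℝ) (f : E → ℝ)
    (x : E) : ℝ :=
  ⨅ h : A, log (∫ ξ, exp (payoff G F γ f x h ξ) ∂P)

namespace ControlledModel

variable (S : ControlledModel P G F ω a b₁ b₂) [IsProbabilityMeasure P]
include S

/-- The tilted transitions contract weighted oscillations. -/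
lemma exists_tilted_contraction [BorelSpace E] {K : ℝ} (hK : 0 ≤ K) :
    ∃ β L : ℝ, β ∈ Set.Ioo (0 : ℝ) 1 ∧ L ∈ Set.Ioo (0 : ℝ) 1 ∧
      ∀ (γ : ℝ) (f₁ f₂ : E → ℝ), |γ| ≤ 1 → Measurable f₁ → Measurable f₂ →
        (∀ z, |f₁ z| ≤ K * (1 + ω z)) → (∀ z, |f₂ z| ≤ K * (1 + ω z)) →
        ∀ (x y : E) (h₁ h₂ : A) (φ : E → ℝ) (D : ℝ), Measurable φ → 0 ≤ D →
          (∀ z, |φ z| ≤ D * (1 + β * ω z)) →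
          ∫ ξ, φ (G x ξ) ∂(P.tilted (payoff G F γ f₁ x h₁)) -
            ∫ ξ, φ (G y ξ) ∂(P.tilted (payoff G F γ f₂ y h₂)) ≤
            L * (D * (2 + β * ω x + β * ω y)) := by
  obtain ⟨hb0, hb1⟩ := S.b₁_mem
  obtain ⟨C, hC, hdrift⟩ := S.exists_tilted_drift hK
  set b : ℝ := (1 + b₁) / 2 with hb
  have hb' : 0 < 1 - b := by linarith
  -- When `ω x + ω y > R` the drift alone beats the additive constant `2 * C`, with a margin paying
  -- for `δ ≤ β`. Otherwise the overlap `α` pays, which is why `β` is small relative to `α`.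
  set R : ℝ := 4 * (C + 1) / (1 - b) with hR
  have hR0 : 0 < R := by positivity
  obtain ⟨α, hα, hover⟩ := S.exists_tilted_overlap hK hR0
  set β : ℝ := min (1 / 2) (α / (2 * (1 + C))) with hβ
  have hβ0 : 0 < β := by positivity
  have hβ1 : β ≤ 1 / 2 := min_le_left _ _
  have hβα : 2 * β + 2 * β * C ≤ α := by
    have : β ≤ α / (2 * (1 + C)) := min_le_right _ _
    rw [le_div_iff₀ (by positivity)] at this
    linarith
  set δ : ℝ := min β ((1 - b) / 2) with hδ
  have hδ0 : 0 < δ := by positivity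
  have hδβ : δ ≤ β := min_le_left _ _
  have hδb : δ ≤ (1 - b) / 2 := min_le_right _ _
  refine ⟨β, 1 - δ, ⟨hβ0, by linarith⟩, ⟨by linarith, by linarith⟩, ?_⟩
  intro γ f₁ f₂ hγ hf₁ hf₂ hfK₁ hfK₂ x y h₁ h₂ φ D hφ hD hφD
  have hωm := S.continuous_ω.measurable
  have hω0 := S.nonneg_ω
  have := S.isProbabilityMeasure_tilted_payoff hγ hK hf₁ hfK₁ x h₁
  have := S.isProbabilityMeasure_tilted_payoff hγ hK hf₂ hfK₂ y h₂
  have d₁ := hdrift γ f₁ hγ hf₁ hfK₁ x h₁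
  have d₂ := hdrift γ f₂ hγ hf₂ hfK₂ y h₂
  have hωB : ∀ z, |ω z| ≤ 1 * (1 + ω z) := fun z => by
    rw [abs_of_nonneg (hω0 z)]; linarith
  have hφB : ∀ z, |φ z| ≤ D * (1 + ω z) := fun z => (hφD z).trans (by
    have := hω0 z
    gcongr
    nlinarith)
  have iω₁ := S.integrable_comp_tilted hγ hK hf₁ hfK₁ hωm zero_le_one hωB x h₁
  have iω₂ := S.integrable_comp_tilted hγ hK hf₂ hfK₂ hωm zero_le_one hωB y h₂
  have iφ₁ := S.integrable_comp_tilted hγ hK hf₁ hfK₁ hφ hD hφB x h₁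
  have iφ₂ := S.integrable_comp_tilted hγ hK hf₂ hfK₂ hφ hD hφB y h₂
  have iβ₁ : Integrable (fun ξ => 1 + β * ω (G x ξ)) (P.tilted (payoff G F γ f₁ x h₁)) :=
    (integrable_const _).add (iω₁.const_mul β)
  have e₁ : ∫ ξ, (D * (1 + β * ω (G x ξ)) - φ (G x ξ)) ∂(P.tilted (payoff G F γ f₁ x h₁)) =
      D * (1 + β * ∫ ξ, ω (G x ξ) ∂(P.tilted (payoff G F γ f₁ x h₁))) -
        ∫ ξ, φ (G x ξ) ∂(P.tilted (payoff G F γ f₁ x h₁)) := by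
    rw [integral_sub (iβ₁.const_mul D) iφ₁,
      integral_const_mul, integral_add (integrable_const _) (iω₁.const_mul β),
      integral_const_mul]
    simp
  have iβ₂ : Integrable (fun ξ => 1 + β * ω (G y ξ)) (P.tilted (payoff G F γ f₂ y h₂)) :=
    (integrable_const _).add (iω₂.const_mul β)
  have e₂ : ∫ ξ, (D * (1 + β * ω (G y ξ)) + φ (G y ξ)) ∂(P.tilted (payoff G F γ f₂ y h₂)) =
      D * (1 + β * ∫ ξ, ω (G y ξ) ∂(P.tilted (payoff G F γ f₂ y h₂))) +
        ∫ ξ, φ (G y ξ) ∂(P.tilted (payoff G F γ f₂ y h₂)) := by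
    rw [integral_add (iβ₂.const_mul D) iφ₂,
      integral_const_mul, integral_add (integrable_const _) (iω₂.const_mul β),
      integral_const_mul]
    simp
  have p₁ : ∀ z, 0 ≤ D * (1 + β * ω z) - φ z := fun z => by linarith [(abs_le.1 (hφD z)).2]
  have p₂ : ∀ z, 0 ≤ D * (1 + β * ω z) + φ z := fun z => by linarith [(abs_le.1 (hφD z)).1]
  -- The nonnegative functions `D * (1 + β * ω) ∓ φ` add up to at least `2 * D`, as the overlap
  -- estimate requires; their integrals turn a lower bound into an upper bound for the difference of
  -- the integrals of `φ`.
  have hlow : (if ω x + ω y ≤ R then α * D else 0) ≤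
      ∫ ξ, (D * (1 + β * ω (G x ξ)) - φ (G x ξ)) ∂(P.tilted (payoff G F γ f₁ x h₁)) +
      ∫ ξ, (D * (1 + β * ω (G y ξ)) + φ (G y ξ)) ∂(P.tilted (payoff G F γ f₂ y h₂)) := by
    split_ifs with hxy
    · have hβω : ∀ z, β * ω z ≤ ω z := fun z => by nlinarith [hω0 z]
      have hDω : ∀ z, D * (1 + β * ω z) ≤ D * (1 + ω z) := fun z =>
        mul_le_mul_of_nonneg_left (by linarith [hβω z]) hD
      refine hover γ f₁ f₂ hγ hf₁ hf₂ hfK₁ hfK₂ x y h₁ h₂ (by linarith [hω0 y])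
        (by linarith [hω0 x]) (fun z => D * (1 + β * ω z) - φ z)
        (fun z => D * (1 + β * ω z) + φ z) (2 * D) D (by fun_prop) (by fun_prop)
        (by positivity) hD p₁ p₂ (fun z => ?_) (fun z => ?_) fun z => ?_
      · rw [abs_of_nonneg (p₁ z)]
        linarith [(abs_le.1 (hφB z)).1, hDω z]
      · rw [abs_of_nonneg (p₂ z)]
        linarith [(abs_le.1 (hφB z)).2, hDω z]
      · have : 0 ≤ D * (β * ω z) := mul_nonneg hD (mul_nonneg hβ0.le (hω0 z))
        linarith
    · exact add_nonneg (integral_nonneg fun ξ => p₁ _) (integral_nonneg fun ξ => p₂ _)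
  rw [e₁, e₂] at hlow
  set I₁ := ∫ ξ, ω (G x ξ) ∂(P.tilted (payoff G F γ f₁ x h₁))
  set I₂ := ∫ ξ, ω (G y ξ) ∂(P.tilted (payoff G F γ f₂ y h₂))
  have hI : D * (β * (I₁ + I₂)) ≤ D * (β * (b * (ω x + ω y) + 2 * C)) := by
    exact mul_le_mul_of_nonneg_left (mul_le_mul_of_nonneg_left (by linarith) hβ0.le) hD
  have hs : 0 ≤ ω x + ω y := add_nonneg (hω0 x) (hω0 y)
  set s := ω x + ω y with hs_def
  have hstep : 2 + β * (b * s + 2 * C) - (if s ≤ R then α else 0) ≤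
      (1 - δ) * (2 + β * s) := by
    have hβs : 0 ≤ β * s := mul_nonneg hβ0.le hs
    split_ifs with hsR
    · have : β * s * b ≤ β * s * (1 - δ) := mul_le_mul_of_nonneg_left (by linarith) hβs
      linarith
    · have h1 : R * (1 - b) ≤ s * (1 - b) :=
        mul_le_mul_of_nonneg_right (not_le.1 hsR).le hb'.le
      have h2 : R * (1 - b) = 4 * (C + 1) := by rw [hR]; field_simp
      have h3 : β * s * ((1 - b) / 2) ≤ β * s * (1 - δ - b) :=
        mul_le_mul_of_nonneg_left (by linarith) hβs
      have h4 : β * (4 * (C + 1)) ≤ β * (s * (1 - b)) :=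
        mul_le_mul_of_nonneg_left (by linarith) hβ0.le
      linarith
  have hfin := mul_le_mul_of_nonneg_left hstep hD
  have hite : D * (if s ≤ R then α else 0) = if s ≤ R then α * D else 0 := by
    split_ifs <;> ring
  linarith

section Continuity

variable [BorelSpace E] [FirstCountableTopology E] [FirstCountableTopology A]

lemma continuous_log_integral_exp_payoff {γ K : ℝ} (hγ : |γ| ≤ 1) (hK : 0 ≤ K) {f : E → ℝ}
    (hf : Continuous f) (hfK : ∀ z, |f z| ≤ K * (1 + ω z)) :
    Continuous fun p : E × A => log (∫ ξ, exp (payoff G F γ f p.1 p.2 ξ) ∂P) := by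
  have hb2 := S.b₂_pos
  refine Continuous.log ?_ fun p =>
    (integral_exp_pos (S.integrable_exp_payoff hγ hK hf.measurable hfK p.1 p.2)).ne'
  refine continuous_iff_continuousAt.2 fun p₀ => ?_
  refine continuousAt_of_dominated
    (bound := fun ξ => exp ((1 + K) * a ξ + (K + (b₂ + K) * (ω p₀.1 + 1))))
    (.of_forall fun p =>
      (S.measurable_payoff hf.measurable γ p.1 p.2).exp.aestronglyMeasurable) ?_
    (integrable_exp_of_le S.integrable_exp ((S.measurable_a.const_mul _).add_const _)
      fun ξ => le_rfl) (ae_of_all _ fun ξ => ?_)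
  · have hω : ContinuousAt (fun p : E × A => ω p.1) p₀ :=
      (S.continuous_ω.comp continuous_fst).continuousAt
    filter_upwards [hω.eventually (gt_mem_nhds (lt_add_one _))] with p hp
    refine ae_of_all _ fun ξ => ?_
    rw [norm_eq_abs, abs_of_pos (exp_pos _), exp_le_exp]
    refine (le_abs_self _).trans ((S.abs_payoff_le hγ hK hfK p.1 p.2 ξ).trans ?_)
    gcongr
  · refine (continuous_exp.comp ?_).continuousAt
    exact ((S.continuous_F ξ).const_mul γ).add (hf.comp ((S.continuous_G ξ).comp continuous_fst))

lemma continuous_bellmanValue [CompactSpace A] {γ K : ℝ} (hγ : |γ| ≤ 1) (hK : 0 ≤ K) {f : E → ℝ}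
    (hf : Continuous f) (hfK : ∀ z, |f z| ≤ K * (1 + ω z)) :
    Continuous (bellmanValue P G F γ f) := by
  have h := isCompact_univ.continuous_sInf (γ := E) (β := A)
    (f := fun x h => log (∫ ξ, exp (payoff G F γ f x h ξ) ∂P))
    (S.continuous_log_integral_exp_payoff hγ hK hf hfK)
  simp only [Set.image_univ, sInf_range] at h
  exact h

lemma exists_eq_bellmanValue [CompactSpace A] [Nonempty A] {γ K : ℝ} (hγ : |γ| ≤ 1) (hK : 0 ≤ K) {f : E → ℝ}
    (hf : Continuous f) (hfK : ∀ z, |f z| ≤ K * (1 + ω z)) (x : E) :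
    ∃ h : A, bellmanValue P G F γ f x = log (∫ ξ, exp (payoff G F γ f x h ξ) ∂P) := by
  have hc : Continuous fun h : A => log (∫ ξ, exp (payoff G F γ f x h ξ) ∂P) :=
    (S.continuous_log_integral_exp_payoff hγ hK hf hfK).comp (by fun_prop : Continuous (Prod.mk x))
  obtain ⟨h, -, hh⟩ := isCompact_univ.exists_isMinOn Set.univ_nonempty hc.continuousOn
  replace hh := fun h' => hh (Set.mem_univ h')
  exact ⟨h, le_antisymm (ciInf_le ⟨_, by rintro _ ⟨h', rfl⟩; exact hh h'⟩ h) (le_ciInf hh)⟩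

end Continuity

lemma bellmanValue_le {γ K : ℝ} (hγ : |γ| ≤ 1) (hK : 0 ≤ K) {f : E → ℝ}
    (hf : Measurable f) (hfK : ∀ z, |f z| ≤ K * (1 + ω z)) (x : E) (h : A) :
    bellmanValue P G F γ f x ≤ log (∫ ξ, exp (payoff G F γ f x h ξ) ∂P) := by
  refine ciInf_le ⟨-(cgf a P (1 + K) + (K + (b₂ + K) * ω x)), ?_⟩ h
  rintro _ ⟨h', rfl⟩
  exact (abs_le.1 (S.abs_log_integral_exp_payoff_le hγ hK hf hfK x h')).1

lemma abs_bellmanValue_le [Nonempty A] {γ K : ℝ} (hγ : |γ| ≤ 1) (hK : 0 ≤ K) {f : E → ℝ}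
    (hf : Measurable f) (hfK : ∀ z, |f z| ≤ K * (1 + ω z)) (x : E) :
    |bellmanValue P G F γ f x| ≤ cgf a P (1 + K) + (K + (b₂ + K) * ω x) := by
  have hb := S.abs_log_integral_exp_payoff_le hγ hK hf hfK x
  rw [abs_le]
  exact ⟨le_ciInf fun h => (abs_le.1 (hb h)).1,
    (S.bellmanValue_le hγ hK hf hfK x (Classical.arbitrary A)).trans (abs_le.1 (hb _)).2⟩

/-- Allows recentring, which converts oscillation bounds into growth bounds. -/
lemma bellmanValue_add_const [Nonempty A] {γ K : ℝ} (hγ : |γ| ≤ 1) (hK : 0 ≤ K) {f : E → ℝ}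
    (hf : Measurable f) (hfK : ∀ z, |f z| ≤ K * (1 + ω z)) (c : ℝ) (x : E) :
    bellmanValue P G F γ (fun z => f z + c) x = bellmanValue P G F γ f x + c := by
  have h1 : ∀ h : A, log (∫ ξ, exp (payoff G F γ (fun z => f z + c) x h ξ) ∂P) =
      log (∫ ξ, exp (payoff G F γ f x h ξ) ∂P) + c := fun h => by
    rw [← log_integral_exp_add_const (S.integrable_exp_payoff hγ hK hf hfK x h)]
    simp only [payoff, add_assoc]
  have hbdd : BddBelow (Set.range fun h : A => log (∫ ξ, exp (payoff G F γ f x h ξ) ∂P)) := by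
    refine ⟨-(cgf a P (1 + K) + (K + (b₂ + K) * ω x)), ?_⟩
    rintro _ ⟨h', rfl⟩
    exact (abs_le.1 (S.abs_log_integral_exp_payoff_le hγ hK hf hfK x h')).1
  simp only [bellmanValue, h1]
  exact ((OrderIso.addRight c).map_ciInf hbdd).symm

variable [BorelSpace E] [FirstCountableTopology E] [FirstCountableTopology A] [CompactSpace A]
  [Nonempty A]

/-- Running the optimal control of `f₂` bounds increments of the Bellman operator. -/
lemma exists_bellmanValue_sub_le {γ K : ℝ} (hγ : |γ| ≤ 1) (hK : 0 ≤ K) {f₁ f₂ : E → ℝ}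
    (hf₁ : Continuous f₁) (hf₂ : Continuous f₂) (hfK₁ : ∀ z, |f₁ z| ≤ K * (1 + ω z))
    (hfK₂ : ∀ z, |f₂ z| ≤ K * (1 + ω z)) (x : E) :
    ∃ h : A, bellmanValue P G F γ f₁ x - bellmanValue P G F γ f₂ x ≤
      ∫ ξ, (f₁ - f₂) (G x ξ) ∂(P.tilted (payoff G F γ f₁ x h)) := by
  obtain ⟨h, hh⟩ := S.exists_eq_bellmanValue (A := A) hγ hK hf₂ hfK₂ x
  refine ⟨h, ?_⟩
  have h1 := S.bellmanValue_le hγ hK hf₁.measurable hfK₁ x h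
  have i₁ := S.integrable_comp_tilted hγ hK hf₁.measurable hfK₁ hf₁.measurable hK hfK₁ x h
  have i₂ := S.integrable_comp_tilted hγ hK hf₁.measurable hfK₁ hf₂.measurable hK hfK₂ x h
  have hd : ∀ ξ, payoff G F γ f₂ x h ξ - payoff G F γ f₁ x h ξ = f₂ (G x ξ) - f₁ (G x ξ) :=
    fun ξ => by simp [payoff]
  have h2 := log_integral_exp_sub_le (S.integrable_exp_payoff hγ hK hf₁.measurable hfK₁ x h)
    (S.integrable_exp_payoff hγ hK hf₂.measurable hfK₂ x h) (by
      simp only [hd]; exact i₂.sub i₁)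
  simp only [hd] at h2
  rw [← integral_neg] at h2
  simp only [neg_sub] at h2
  rw [hh]
  simp only [Pi.sub_apply]
  linarith

/-- The Bellman operator is a contraction modulo constants on functions of bounded growth. -/
lemma exists_bellmanValue_contraction {K : ℝ} (hK : 0 ≤ K) :
    ∃ β L : ℝ, β ∈ Set.Ioo (0 : ℝ) 1 ∧ L ∈ Set.Ioo (0 : ℝ) 1 ∧
      ∀ (γ : ℝ) (f₁ f₂ : E → ℝ), |γ| ≤ 1 → Continuous f₁ → Continuous f₂ →
        (∀ z, |f₁ z| ≤ K * (1 + ω z)) → (∀ z, |f₂ z| ≤ K * (1 + ω z)) →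
        ∀ D s : ℝ, 0 ≤ D → (∀ z, |f₁ z - f₂ z - s| ≤ D * (1 + β * ω z)) → ∀ x y : E,
          (bellmanValue P G F γ f₁ x - bellmanValue P G F γ f₂ x) -
            (bellmanValue P G F γ f₁ y - bellmanValue P G F γ f₂ y) ≤
            L * (D * (2 + β * ω x + β * ω y)) := by
  obtain ⟨β, L, hβ, hL, hQ⟩ := S.exists_tilted_contraction hK
  refine ⟨β, L, hβ, hL, ?_⟩
  intro γ f₁ f₂ hγ hf₁ hf₂ hfK₁ hfK₂ D s hD hfD x y
  obtain ⟨h₁, hh₁⟩ := S.exists_bellmanValue_sub_le hγ hK hf₁ hf₂ hfK₁ hfK₂ x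
  obtain ⟨h₂, hh₂⟩ := S.exists_bellmanValue_sub_le hγ hK hf₂ hf₁ hfK₂ hfK₁ y
  -- The shift `s` cancels because both tilted measures are probabilities.
  have key := hQ γ f₁ f₂ hγ hf₁.measurable hf₂.measurable hfK₁ hfK₂ x y h₁ h₂
    (fun z => f₁ z - f₂ z - s) D ((hf₁.sub hf₂).sub continuous_const).measurable hD hfD
  have := S.isProbabilityMeasure_tilted_payoff hγ hK hf₁.measurable hfK₁ x h₁
  have := S.isProbabilityMeasure_tilted_payoff hγ hK hf₂.measurable hfK₂ y h₂
  have i₁ : Integrable (fun ξ => f₁ (G x ξ) - f₂ (G x ξ)) (P.tilted (payoff G F γ f₁ x h₁)) :=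
    (S.integrable_comp_tilted hγ hK hf₁.measurable hfK₁ hf₁.measurable hK hfK₁ x h₁).sub
      (S.integrable_comp_tilted hγ hK hf₁.measurable hfK₁ hf₂.measurable hK hfK₂ x h₁)
  have i₂ : Integrable (fun ξ => f₁ (G y ξ) - f₂ (G y ξ)) (P.tilted (payoff G F γ f₂ y h₂)) :=
    (S.integrable_comp_tilted hγ hK hf₂.measurable hfK₂ hf₁.measurable hK hfK₁ y h₂).sub
      (S.integrable_comp_tilted hγ hK hf₂.measurable hfK₂ hf₂.measurable hK hfK₂ y h₂)
  rw [integral_sub i₁ (integrable_const _), integral_sub i₂ (integrable_const _)] at key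
  have hneg : ∫ ξ, (f₂ - f₁) (G y ξ) ∂(P.tilted (payoff G F γ f₂ y h₂)) =
      -∫ ξ, (f₁ (G y ξ) - f₂ (G y ξ)) ∂(P.tilted (payoff G F γ f₂ y h₂)) := by
    rw [← integral_neg]; simp
  rw [hneg] at hh₂
  simp only [Pi.sub_apply, integral_const, probReal_univ, one_smul] at hh₁ key
  linarith

end ControlledModel

end Bellman

/-! ### Weighted oscillation as a quotient norm modulo constants. -/

section Oscillation

variable {E : Type*} {ω : E → ℝ} {β D : ℝ} {f : E → ℝ}

/-- The weighted oscillation of `f` is at most `D`. -/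
def OscLE (ω : E → ℝ) (β D : ℝ) (f : E → ℝ) : Prop :=
  ∀ x y, f x - f y ≤ D * (2 + β * ω x + β * ω y)

lemma OscLE.abs_sub_le (hf : OscLE ω β D f) (x y : E) :
    |f x - f y| ≤ D * (2 + β * ω x + β * ω y) :=
  abs_le.2 ⟨by linarith [hf y x], hf x y⟩

lemma OscLE.mono_weight (hω : ∀ x, 0 ≤ ω x) (hD : 0 ≤ D) {β' : ℝ} (hβ : β ≤ β')
    (hf : OscLE ω β D f) : OscLE ω β' D f := fun x y =>
  (hf x y).trans (mul_le_mul_of_nonneg_left (by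
    have h1 := mul_le_mul_of_nonneg_right hβ (hω x)
    have h2 := mul_le_mul_of_nonneg_right hβ (hω y)
    linarith) hD)

/-- Every value of `f - D * (1 + β * ω)` lies below every value of `f + D * (1 + β * ω)`, so the
supremum of the former separates them. -/
lemma OscLE.exists_center [Nonempty E] (hf : OscLE ω β D f) :
    ∃ s : ℝ, ∀ x, |f x - s| ≤ D * (1 + β * ω x) := by
  have hle : ∀ x y, f x - D * (1 + β * ω x) ≤ f y + D * (1 + β * ω y) := fun x y => by
    linarith [hf x y]
  refine ⟨⨆ x, (f x - D * (1 + β * ω x)), fun y => abs_le.2 ⟨?_, ?_⟩⟩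
  · have := ciSup_le fun x => hle x y
    linarith
  · have := le_ciSup (f := fun x => f x - D * (1 + β * ω x))
      ⟨_, by rintro _ ⟨x, rfl⟩; exact hle x y⟩ y
    linarith

end Oscillation

/-! ### Local contraction and Picard iteration. -/

section FixedPoint

variable {Ω E A : Type*} [MeasurableSpace Ω] [TopologicalSpace E] [MeasurableSpace E]
  [TopologicalSpace A] [BorelSpace E] [FirstCountableTopology E] [FirstCountableTopology A]
  [CompactSpace A] [Nonempty A]
  {P : Measure Ω} {G : E → Ω → E} {F : E → A → Ω → ℝ} {ω : E → ℝ} {a : Ω → ℝ} {b₁ b₂ : ℝ}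

namespace ControlledModel

variable (S : ControlledModel P G F ω a b₁ b₂) [IsProbabilityMeasure P]
include S

/-- The Bellman operator is a local contraction modulo constants. -/
lemma exists_local_contraction [Nonempty E] {M : ℝ} (hM : 0 ≤ M) :
    ∃ β L : ℝ, β ∈ Set.Ioo (0 : ℝ) 1 ∧ L ∈ Set.Ioo (0 : ℝ) 1 ∧
      ∀ (γ : ℝ) (f₁ f₂ : E → ℝ), |γ| ≤ 1 → Continuous f₁ → Continuous f₂ →
        OscLE ω 1 M f₁ → OscLE ω 1 M f₂ → ∀ D : ℝ, 0 ≤ D →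
        OscLE ω β D (fun x => f₁ x - f₂ x) →
        OscLE ω β (L * D) fun x => bellmanValue P G F γ f₁ x - bellmanValue P G F γ f₂ x := by
  obtain ⟨β, L, hβ, hL, hT⟩ := S.exists_bellmanValue_contraction hM
  refine ⟨β, L, hβ, hL, ?_⟩
  intro γ f₁ f₂ hγ hf₁ hf₂ ho₁ ho₂ D hD ho x y
  obtain ⟨s₁, hs₁⟩ := ho₁.exists_center
  obtain ⟨s₂, hs₂⟩ := ho₂.exists_center
  obtain ⟨s, hs⟩ := ho.exists_center
  simp only [one_mul] at hs₁ hs₂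
  have hc₁ : Continuous fun z => f₁ z - s₁ := hf₁.sub continuous_const
  have hc₂ : Continuous fun z => f₂ z - s₂ := hf₂.sub continuous_const
  have e₁ : ∀ z, bellmanValue P G F γ f₁ z = bellmanValue P G F γ (fun z => f₁ z - s₁) z + s₁ :=
    fun z => by
      rw [← S.bellmanValue_add_const hγ hM hc₁.measurable hs₁]
      simp only [sub_add_cancel]
  have e₂ : ∀ z, bellmanValue P G F γ f₂ z = bellmanValue P G F γ (fun z => f₂ z - s₂) z + s₂ :=
    fun z => by
      rw [← S.bellmanValue_add_const hγ hM hc₂.measurable hs₂]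
      simp only [sub_add_cancel]
  have key := hT γ _ _ hγ hc₁ hc₂ hs₁ hs₂ D (s - s₁ + s₂) hD (fun z => by
    have := hs z
    rwa [show f₁ z - s₁ - (f₂ z - s₂) - (s - s₁ + s₂) = f₁ z - f₂ z - s by ring]) x y
  simp only [e₁, e₂]
  linarith

/-- What matters is the factor `|γ|`. Convexity of `exp` gives `exp (|γ| * a) ≤ |γ| * exp a + 1 -
|γ|`, and `log t ≤ t - 1` then makes the log-moment linear in `|γ|`. -/
lemma abs_bellmanValue_zero_le {γ : ℝ} (hγ : |γ| ≤ 1) (x : E) :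
    |bellmanValue P G F γ (fun _ => 0) x| ≤ |γ| * (mgf a P 1 + b₂ * ω x) := by
  obtain ⟨h, hh⟩ := S.exists_eq_bellmanValue (A := A) hγ le_rfl
    (f := fun _ => (0 : ℝ)) continuous_const (fun z => by simp) x
  have hb : ∀ ξ, |payoff G F γ (fun _ => 0) x h ξ| ≤ |γ| * a ξ + |γ| * (b₂ * ω x) := fun ξ => by
    rw [payoff, add_zero, abs_mul, ← mul_add]
    exact mul_le_mul_of_nonneg_left (S.growth_F x h ξ) (abs_nonneg _)
  have hm := S.measurable_payoff (f := fun _ => (0 : ℝ)) measurable_const γ x h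
  have hcgf : cgf a P |γ| ≤ |γ| * mgf a P 1 := by
    have h1 : mgf a P |γ| ≤ |γ| * mgf a P 1 + (1 - |γ|) := by
      calc mgf a P |γ| ≤ ∫ ξ, (|γ| * exp (1 * a ξ) + (1 - |γ|)) ∂P := by
            refine integral_mono (S.integrable_exp _)
              (((S.integrable_exp 1).const_mul _).add (integrable_const _)) fun ξ => ?_
            have := convexOn_exp.2 (Set.mem_univ (a ξ)) (Set.mem_univ 0) (abs_nonneg γ)
              (by linarith : 0 ≤ 1 - |γ|) (by ring)
            simpa using this
        _ = _ := by
            rw [integral_add ((S.integrable_exp 1).const_mul _) (integrable_const _),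
              integral_const_mul]
            simp [mgf]
    have h2 : 0 < mgf a P |γ| := integral_exp_pos (S.integrable_exp _)
    have h3 := log_le_sub_one_of_pos h2
    rw [cgf]
    linarith [abs_nonneg γ]
  rw [hh]
  refine le_trans (abs_le.2 ⟨neg_le_log_integral_exp S.integrable_exp S.measurable_a S.nonneg_a
    (integrable_exp_of_le S.integrable_exp hm fun ξ => (abs_le.1 (hb ξ)).2) (abs_nonneg γ)
    fun ξ => (abs_le.1 (hb ξ)).1, log_integral_exp_le S.integrable_exp hm
    fun ξ => (abs_le.1 (hb ξ)).2⟩) ?_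
  linarith

/-- For small risk aversion, the image of `0` under the Bellman operator has small oscillation. -/
lemma exists_forall_oscLE_bellmanValue_zero {β ε : ℝ} (hβ : 0 < β) (hε : 0 < ε) :
    ∃ γ₀ : ℝ, 0 < γ₀ ∧ γ₀ ≤ 1 ∧ ∀ γ : ℝ, |γ| ≤ γ₀ →
      OscLE ω β ε (bellmanValue P G F γ fun _ => 0) := by
  have hb2 := S.b₂_pos
  have hm : 0 ≤ mgf a P 1 := mgf_nonneg
  refine ⟨min 1 (ε / (mgf a P 1 + b₂ / β)), by positivity, min_le_left _ _, ?_⟩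
  intro γ hγ x y
  have hγ1 : |γ| ≤ 1 := hγ.trans (min_le_left _ _)
  have hγ2 : |γ| * (mgf a P 1 + b₂ / β) ≤ ε := by
    rw [← le_div_iff₀ (by positivity)]
    exact hγ.trans (min_le_right _ _)
  have h1 := (abs_le.1 (S.abs_bellmanValue_zero_le hγ1 x)).2
  have h2 := (abs_le.1 (S.abs_bellmanValue_zero_le hγ1 y)).1
  have hx := S.nonneg_ω x
  have hy := S.nonneg_ω y
  calc _ ≤ |γ| * (mgf a P 1 + b₂ * ω x) + |γ| * (mgf a P 1 + b₂ * ω y) := by linarith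
    _ = |γ| * (mgf a P 1 * 2 + b₂ / β * (β * ω x + β * ω y)) := by field_simp; ring
    _ ≤ |γ| * ((mgf a P 1 + b₂ / β) * (2 + β * ω x + β * ω y)) := by
        gcongr
        have : 0 ≤ mgf a P 1 * (β * ω x + β * ω y) := by positivity
        have : 0 ≤ b₂ / β := by positivity
        linarith
    _ = |γ| * (mgf a P 1 + b₂ / β) * (2 + β * ω x + β * ω y) := by ring
    _ ≤ _ := by gcongr

/-- Picard iteration for the Bellman operator modulo constants. -/
lemma exists_bellman_fixedPoint [Nonempty E] {γ β L : ℝ} (hγ : |γ| ≤ 1) (hβ : β ∈ Set.Ioo (0 : ℝ) 1)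
    (hL : L ∈ Set.Ioo (0 : ℝ) 1)
    (hT : ∀ f₁ f₂ : E → ℝ, Continuous f₁ → Continuous f₂ →
        OscLE ω 1 1 f₁ → OscLE ω 1 1 f₂ → ∀ D : ℝ, 0 ≤ D →
        OscLE ω β D (fun x => f₁ x - f₂ x) →
        OscLE ω β (L * D) fun x => bellmanValue P G F γ f₁ x - bellmanValue P G F γ f₂ x)
    (hT₀ : OscLE ω β (1 - L) (bellmanValue P G F γ fun _ => 0)) :
    ∃ (u : E → ℝ) (c : ℝ), Continuous u ∧ OscLE ω 1 1 u ∧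
      ∀ x, u x + c = bellmanValue P G F γ u x := by
  have hω := S.nonneg_ω
  let z : E := Classical.arbitrary E
  have one : ∀ {f : E → ℝ}, OscLE ω β 1 f → OscLE ω 1 1 f := fun hf =>
    hf.mono_weight hω zero_le_one hβ.2.le
  -- Iterates are normalized to vanish at `z`, so that oscillation bounds become pointwise bounds.
  let v : ℕ → E → ℝ := fun n => n.rec (fun _ => 0)
    fun _ f x => bellmanValue P G F γ f x - bellmanValue P G F γ f z
  have hv0 : v 0 = fun _ => 0 := rfl
  have hvs : ∀ n x, v (n + 1) x = bellmanValue P G F γ (v n) x - bellmanValue P G F γ (v n) z :=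
    fun n x => rfl
  have hcontT : ∀ f : E → ℝ, Continuous f → OscLE ω 1 1 f →
      Continuous (bellmanValue P G F γ f) := fun f hf ho => by
    obtain ⟨s, hs⟩ := ho.exists_center
    simp only [one_mul] at hs
    have hc : Continuous fun x => f x - s := hf.sub continuous_const
    have hs' : ∀ x, |f x - s| ≤ 1 * (1 + ω x) := fun x => by rw [one_mul]; exact hs x
    have h1 := (S.continuous_bellmanValue hγ zero_le_one hc hs').add (continuous_const (y := s))
    refine h1.congr fun x => ?_
    rw [Pi.add_apply, ← S.bellmanValue_add_const hγ zero_le_one hc.measurable hs']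
    simp only [sub_add_cancel]
  have hz0 : OscLE ω β 1 (fun _ : E => (0 : ℝ)) := fun x y => by
    have h1 := mul_nonneg hβ.1.le (hω x)
    have h2 := mul_nonneg hβ.1.le (hω y)
    simp only [sub_self]
    linarith
  have hv : ∀ n, Continuous (v n) ∧ OscLE ω β 1 (v n) ∧ v n z = 0 := by
    intro n
    induction n with
    | zero => exact ⟨continuous_const, hz0, rfl⟩
    | succ n ih =>
      obtain ⟨hc, ho, -⟩ := ih
      refine ⟨(hcontT _ hc (one ho)).sub continuous_const, fun x y => ?_, sub_self _⟩
      -- Invariance of the unit ball: `L * 1 + (1 - L) = 1`.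
      have h1 := hT (v n) (fun _ => 0) hc continuous_const (one ho) (one hz0) 1 zero_le_one
        (by simpa using ho) x y
      have h2 := hT₀ x y
      rw [hvs, hvs]
      linarith
  have hdiff : ∀ n k, OscLE ω β (L ^ n) fun x => v (n + k) x - v n x := by
    intro n
    induction n with
    | zero =>
      intro k
      have := (hv k).2.1
      simpa [hv0] using this
    | succ n ih =>
      intro k x y
      have h1 := hT _ _ (hv (n + k)).1 (hv n).1 (one (hv (n + k)).2.1) (one (hv n).2.1)
        (L ^ n) (pow_nonneg hL.1.le n) (ih k) x y
      rw [show n + 1 + k = n + k + 1 by omega]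
      simp only [hvs]
      rw [pow_succ, mul_comm (L ^ n)]
      linarith
  set w : E → ℝ := fun x => 2 + β * ω x + β * ω z with hw
  have hw0 : ∀ x, 0 < w x := fun x => by
    have h1 := mul_nonneg hβ.1.le (hω x)
    have h2 := mul_nonneg hβ.1.le (hω z)
    simp only [hw]
    linarith
  have hdist : ∀ n k x, |v (n + k) x - v n x| ≤ L ^ n * w x := fun n k x => by
    have := (hdiff n k).abs_sub_le x z
    rwa [(hv _).2.2, (hv _).2.2, sub_zero, sub_zero] at this
  have hlim : ∀ x, ∃ l, Tendsto (fun n => v n x) atTop (𝓝 l) := fun x =>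
    cauchySeq_tendsto_of_complete (cauchySeq_of_le_geometric L (w x) hL.2 fun n => by
      rw [dist_comm, dist_eq, mul_comm]
      exact hdist n 1 x)
  choose u hu using hlim
  have hushift : ∀ n x, Tendsto (fun k => v (n + k) x) atTop (𝓝 (u x)) := fun n x =>
    (hu x).comp (tendsto_atTop_mono (fun k => Nat.le_add_left k n) tendsto_id)
  have hudist : ∀ n x, |u x - v n x| ≤ L ^ n * w x := fun n x =>
    le_of_tendsto ((hushift n x).sub_const _).abs (.of_forall fun k => hdist n k x)
  have hudiff : ∀ n, OscLE ω β (L ^ n) fun x => u x - v n x := fun n x y =>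
    le_of_tendsto (((hushift n x).sub_const (v n x)).sub ((hushift n y).sub_const (v n y)))
      (.of_forall fun k => hdiff n k x y)
  have huo : OscLE ω β 1 u := fun x y =>
    le_of_tendsto ((hu x).sub (hu y)) (.of_forall fun n => (hv n).2.1 x y)
  have hLn := tendsto_pow_atTop_nhds_zero_of_lt_one hL.1.le hL.2
  have hwc : Continuous w :=
    (continuous_const.add (S.continuous_ω.const_mul β)).add continuous_const
  have huc : Continuous u := by
    -- Convergence is uniform only relative to the possibly unbounded weight `w`; that suffices for
    -- continuity.
    have hunif : TendstoUniformly (fun n x => v n x / w x) (fun x => u x / w x) atTop := by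
      rw [Metric.tendstoUniformly_iff]
      intro ε hε
      filter_upwards [hLn.eventually (gt_mem_nhds hε)] with n hn x
      rw [dist_eq, ← sub_div, abs_div, abs_of_pos (hw0 x), div_lt_iff₀ (hw0 x)]
      exact (hudist n x).trans_lt (mul_lt_mul_of_pos_right hn (hw0 x))
    have h1 := hunif.continuous (.of_forall fun n => (hv n).1.div hwc fun x => (hw0 x).ne')
    exact (h1.mul hwc).congr fun x => div_mul_cancel₀ _ (hw0 x).ne'
  refine ⟨u, bellmanValue P G F γ u z, huc, one huo, fun x => ?_⟩
  have hle : ∀ n, |bellmanValue P G F γ u x - bellmanValue P G F γ u z - v (n + 1) x| ≤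
      L ^ (n + 1) * w x := fun n => by
    have h1 := (hT u (v n) huc (hv n).1 (one huo) (one (hv n).2.1) _ (pow_nonneg hL.1.le n)
      (hudiff n)).abs_sub_le x z
    rw [hvs, pow_succ, mul_comm (L ^ n)]
    convert h1 using 2
    ring
  have hconst : |bellmanValue P G F γ u x - bellmanValue P G F γ u z - u x| ≤ 0 * w x :=
    le_of_tendsto_of_tendsto'
      (((hu x).comp (tendsto_add_atTop_nat 1)).const_sub _).abs
      ((hLn.comp (tendsto_add_atTop_nat 1)).mul_const (w x)) hle
  rw [zero_mul] at hconst
  have := abs_nonpos_iff.1 hconst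
  linarith

end ControlledModel

end FixedPoint

/-! ### Weighted span seminorms on `C_ω`. -/

section Span

variable {k : ℕ} {ω f : Vec k → ℝ}

lemma MemCω.exists_bound (hω : ∀ x, 0 ≤ ω x) (hf : MemCω ω f) :
    ∃ K : ℝ, 0 ≤ K ∧ ∀ x, |f x| ≤ K * (1 + ω x) := by
  obtain ⟨K, hK⟩ := hf.2
  have h : ∀ x, |f x| ≤ K * (1 + ω x) := fun x => by
    rw [← div_le_iff₀ (by linarith [hω x])]
    exact hK ⟨x, rfl⟩
  refine ⟨K, ?_, h⟩
  have h0 := hω 0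
  exact nonneg_of_mul_nonneg_left ((abs_nonneg _).trans (h 0)) (by linarith)

lemma memCω_of_bound (hω : ∀ x, 0 ≤ ω x) (hf : Continuous f) {K : ℝ}
    (h : ∀ x, |f x| ≤ K * (1 + ω x)) : MemCω ω f := by
  refine ⟨hf, K, ?_⟩
  rintro _ ⟨x, rfl⟩
  simp only []
  rw [div_le_iff₀ (by linarith [hω x])]
  exact h x

lemma MemCω.sub (hω : ∀ x, 0 ≤ ω x) {g : Vec k → ℝ} (hf : MemCω ω f) (hg : MemCω ω g) :
    MemCω ω (f - g) := by
  obtain ⟨K, -, hK⟩ := hf.exists_bound hω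
  obtain ⟨K', -, hK'⟩ := hg.exists_bound hω
  refine memCω_of_bound hω (hf.1.sub hg.1) (K := K + K') fun x => ?_
  rw [Pi.sub_apply, add_mul]
  exact (abs_sub _ _).trans (add_le_add (hK x) (hK' x))

lemma MemCω.oscLE_spanSeminorm (hω : ∀ x, 0 ≤ ω x) {β : ℝ} (hβ : 0 < β) (hf : MemCω ω f) :
    OscLE ω β (spanSeminorm β ω f) f := by
  obtain ⟨K, hK0, hK⟩ := hf.exists_bound hω
  have hpos : ∀ x y, 0 < 2 + β * ω x + β * ω y := fun x y => by
    have h1 := mul_nonneg hβ.le (hω x)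
    have h2 := mul_nonneg hβ.le (hω y)
    linarith
  have hbdd : BddAbove (Set.range fun p : Vec k × Vec k =>
      (f p.1 - f p.2) / (2 + β * ω p.1 + β * ω p.2)) := by
    refine ⟨K * (1 + 1 / β), ?_⟩
    rintro _ ⟨⟨x, y⟩, rfl⟩
    simp only []
    rw [div_le_iff₀ (hpos x y)]
    have h1 := (abs_le.1 (hK x)).2
    have h2 := (abs_le.1 (hK y)).1
    have hx := hω x
    have hy := hω y
    calc f x - f y ≤ K * (2 + ω x + ω y) := by linarith
      -- The added term completes the product `(1 + 1 / β) * (2 + β * ω x + β * ω y)`.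
      _ ≤ K * (2 + ω x + ω y + (2 / β + β * ω x + β * ω y)) := by
          have : 0 ≤ 2 / β + β * ω x + β * ω y := by positivity
          exact mul_le_mul_of_nonneg_left (by linarith) hK0
      _ = _ := by field_simp; ring
  intro x y
  rw [← div_le_iff₀ (hpos x y)]
  exact le_ciSup hbdd (x, y)

lemma spanSeminorm_le (hω : ∀ x, 0 ≤ ω x) {β D : ℝ} (hβ : 0 < β) (hf : OscLE ω β D f) :
    spanSeminorm β ω f ≤ D := by
  refine ciSup_le fun p => ?_
  have h1 := mul_nonneg hβ.le (hω p.1)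
  have h2 := mul_nonneg hβ.le (hω p.2)
  rw [div_le_iff₀ (by linarith)]
  exact hf p.1 p.2

lemma MemCω.spanSeminorm_nonneg (hω : ∀ x, 0 ≤ ω x) {β : ℝ} (hβ : 0 < β) (hf : MemCω ω f) :
    0 ≤ spanSeminorm β ω f := by
  have h := hf.oscLE_spanSeminorm hω hβ 0 0
  have h1 := mul_nonneg hβ.le (hω 0)
  rw [sub_self] at h
  exact nonneg_of_mul_nonneg_left h (by linarith)

lemma OscLE.mono (hω : ∀ x, 0 ≤ ω x) {β D D' : ℝ} (hβ : 0 ≤ β) (hD : D ≤ D')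
    (hf : OscLE ω β D f) : OscLE ω β D' f := fun x y =>
  (hf x y).trans (mul_le_mul_of_nonneg_right hD (by
    have h1 := mul_nonneg hβ (hω x)
    have h2 := mul_nonneg hβ (hω y)
    linarith))

end Span

/-! ### From the extended-real assumptions to the real-valued model. -/

section Reduction

variable {Ω : Type*} [MeasurableSpace Ω] {P : Measure Ω}

lemma logExpMoment_eq_coe [IsProbabilityMeasure P] {Z : Ω → ℝ}
    (hZ : Integrable (fun ξ => exp (Z ξ)) P) :
    logExpMoment P Z = (log (∫ ξ, exp (Z ξ) ∂P) : ℝ) := by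
  rw [logExpMoment, ← ofReal_integral_eq_lintegral_ofReal hZ (ae_of_all _ fun _ => (exp_pos _).le),
    ENNReal.log_ofReal_of_pos (integral_exp_pos hZ)]

lemma integrable_exp_of_entropicUtility_eq_coe {Z : Ω → ℝ} (hZ : Measurable Z) {γ r : ℝ}
    (hγ : 0 < γ) (h : entropicUtility P γ Z = (r : EReal)) :
    Integrable (fun ξ => exp (γ * Z ξ)) P := by
  refine ⟨by fun_prop, ?_⟩
  rw [hasFiniteIntegral_iff_ofReal (ae_of_all _ fun _ => (exp_pos _).le), lt_top_iff_ne_top]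
  intro htop
  rw [entropicUtility, if_neg hγ.ne', logExpMoment, htop, ENNReal.log_top,
    EReal.coe_mul_top_of_pos (by positivity)] at h
  exact EReal.coe_ne_top r h.symm

variable {k m : ℕ} {W : ℕ → Ω → Vec (k + m)} {G : Vec k → Vec (k + m) → Vec k} {U : Set (Vec m)}
  {F : Vec k → U → Vec (k + m) → ℝ} {ω : Vec k → ℝ} {a₁ a₂ : Vec (k + m) → ℝ} {b₁ b₂ : ℝ}

lemma GrowthAssumption.integrable_exp [IsProbabilityMeasure P]
    (h : GrowthAssumption P W G F ω a₁ a₂ b₁ b₂) (hW : Measurable (W 0)) (s : ℝ) :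
    Integrable (fun ξ => exp (s * (a₁ (W 0 ξ) + a₂ (W 0 ξ)))) P := by
  -- Since `a₁ + a₂` is at most twice the larger of the two, doubling the exponent avoids any joint
  -- moment; adding `1` keeps it positive.
  have hs : 0 < 2 * (|s| + 1) := by positivity
  obtain ⟨r₁, hr₁⟩ := h.finite_a₁ (2 * (|s| + 1))
  obtain ⟨r₂, hr₂⟩ := h.finite_a₂ (2 * (|s| + 1))
  have hm₁ : Measurable fun ξ => a₁ (W 0 ξ) := h.measurable_a₁.comp hW
  have hm₂ : Measurable fun ξ => a₂ (W 0 ξ) := h.measurable_a₂.comp hW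
  refine ((integrable_exp_of_entropicUtility_eq_coe hm₁ hs hr₁).add
    (integrable_exp_of_entropicUtility_eq_coe hm₂ hs hr₂)).mono'
    ((hm₁.add hm₂).const_mul s).exp.aestronglyMeasurable
    (ae_of_all _ fun ξ => ?_)
  rw [norm_eq_abs, abs_of_pos (exp_pos _), Pi.add_apply]
  have h1 := h.nonneg_a₁ (W 0 ξ)
  have h2 := h.nonneg_a₂ (W 0 ξ)
  have hs' : s ≤ |s| + 1 := by linarith [le_abs_self s]
  have hs0 : 0 ≤ |s| + 1 := by positivity
  have hle := mul_le_mul_of_nonneg_right hs' (add_nonneg h1 h2)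
  rcases le_total (a₁ (W 0 ξ)) (a₂ (W 0 ξ)) with h' | h'
  · have := mul_le_mul_of_nonneg_left h' hs0
    exact (exp_le_exp.2 (by linarith)).trans (le_add_of_nonneg_left (exp_pos _).le)
  · have := mul_le_mul_of_nonneg_left h' hs0
    exact (exp_le_exp.2 (by linarith)).trans (le_add_of_nonneg_right (exp_pos _).le)

lemma GrowthAssumption.controlledModel [IsProbabilityMeasure P]
    (h : GrowthAssumption P W G F ω a₁ a₂ b₁ b₂) (hW : Measurable (W 0))
    (hGm : Measurable fun p : Vec k × Vec (k + m) => G p.1 p.2)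
    (hGc : ∀ w, Continuous fun x => G x w)
    (hFm : Measurable fun p : Vec k × U × Vec (k + m) => F p.1 p.2.1 p.2.2)
    (hFc : ∀ w, Continuous fun p : Vec k × U => F p.1 p.2 w)
    (hmin : MinorizationAssumption P W G ω) :
    ControlledModel P (fun x ξ => G x (W 0 ξ)) (fun x (h : U) ξ => F x h (W 0 ξ)) ω
      (fun ξ => a₁ (W 0 ξ) + a₂ (W 0 ξ)) b₁ b₂ where
  measurable_G x := hGm.comp (measurable_const.prodMk hW)
  measurable_F x u := hFm.comp (measurable_const.prodMk (measurable_const.prodMk hW))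
  continuous_G ξ := hGc _
  continuous_F ξ := hFc _
  continuous_ω := h.continuous_ω
  nonneg_ω := h.nonneg_ω
  measurable_a := (h.measurable_a₁.comp hW).add (h.measurable_a₂.comp hW)
  nonneg_a ξ := add_nonneg (h.nonneg_a₁ _) (h.nonneg_a₂ _)
  integrable_exp := h.integrable_exp hW
  b₁_mem := h.b₁_mem
  b₂_pos := h.b₂_pos
  growth_G x ξ := by
    have := h.growth_G x (W 0 ξ)
    have := h.nonneg_a₂ (W 0 ξ)
    linarith
  growth_F x u ξ := by
    have := h.growth_F x u (W 0 ξ)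
    have := h.nonneg_a₁ (W 0 ξ)
    linarith
  minorization R hR := by
    obtain ⟨c, hc, ν, hν, hle⟩ := hmin R hR
    refine ⟨c, hc, ν, hν, fun x hx => Measure.le_iff.2 fun A hA => ?_⟩
    have hGx : Measurable fun ξ => G x (W 0 ξ) := hGm.comp (measurable_const.prodMk hW)
    rw [Measure.map_apply hGx hA]
    exact hle A hA x hx

/-- The infimum is attained, so it is the same in the reals and in the extended reals. -/
lemma bellmanOp_eq_bellmanValue [IsProbabilityMeasure P] [CompactSpace U] [Nonempty U]
    {a : Ω → ℝ} (S : ControlledModel P (fun x ξ => G x (W 0 ξ))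
      (fun x (h : U) ξ => F x h (W 0 ξ)) ω a b₁ b₂)
    {γ : ℝ} (hγ : |γ| ≤ 1) {f : Vec k → ℝ} (hf : MemCω ω f) (x : Vec k) :
    bellmanOp P W G F γ f x =
      (bellmanValue P (fun x ξ => G x (W 0 ξ)) (fun x (h : U) ξ => F x h (W 0 ξ)) γ f x : ℝ) := by
  obtain ⟨K, hK0, hK⟩ := hf.exists_bound S.nonneg_ω
  have hlog : ∀ h : U, logExpMoment P (fun ξ => γ * F x h (W 0 ξ) + f (G x (W 0 ξ))) =
      (log (∫ ξ, exp (payoff (fun x ξ => G x (W 0 ξ)) (fun x (h : U) ξ => F x h (W 0 ξ))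
        γ f x h ξ) ∂P) : ℝ) := fun h =>
    logExpMoment_eq_coe (S.integrable_exp_payoff hγ hK0 hf.1.measurable hK x h)
  rw [bellmanOp]
  apply le_antisymm
  · obtain ⟨h, hh⟩ := S.exists_eq_bellmanValue hγ hK0 hf.1 hK x
    rw [hh, ← hlog]
    exact iInf_le _ h
  · refine le_iInf fun h => ?_
    rw [hlog, EReal.coe_le_coe_iff]
    exact S.bellmanValue_le hγ hK0 hf.1.measurable hK x h

lemma memCω_bellmanValue [IsProbabilityMeasure P] [CompactSpace U] [Nonempty U]
    {G : Vec k → Ω → Vec k} {F : Vec k → U → Ω → ℝ}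
    {a : Ω → ℝ} (S : ControlledModel P G F ω a b₁ b₂)
    {γ : ℝ} (hγ : |γ| ≤ 1) {f : Vec k → ℝ} (hf : MemCω ω f) :
    MemCω ω (bellmanValue P G F γ f) := by
  obtain ⟨K, hK0, hK⟩ := hf.exists_bound S.nonneg_ω
  refine memCω_of_bound S.nonneg_ω (S.continuous_bellmanValue hγ hK0 hf.1 hK)
    (K := cgf a P (1 + K) + K + b₂) fun x => ?_
  refine (S.abs_bellmanValue_le hγ hK0 hf.1.measurable hK x).trans ?_
  have h1 := mul_nonneg (S.cgf_nonneg (s := 1 + K) (by positivity)) (S.nonneg_ω x)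
  have h2 := S.b₂_pos
  linarith

end Reduction

end RiskSensitive

/-! ### The main theorem. -/

open RiskSensitive in
theorem mainTheorem2
    {Ω : Type*} [MeasurableSpace Ω] (P : Measure Ω) [IsProbabilityMeasure P]
    (k m : ℕ) (W : ℕ → Ω → Vec (k + m))
    (G : Vec k → Vec (k + m) → Vec k) (x₀ : Vec k) (X : ℕ → Ω → Vec k)
    (U : Set (Vec m)) (hU : IsCompact U) (hU_ne : U.Nonempty)
    (F : Vec k → U → Vec (k + m) → ℝ) (V₀ : ℝ) (V : (ℕ → Ω → U) → ℕ → Ω → ℝ)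
    (ω : Vec k → ℝ) (a₁ a₂ : Vec (k + m) → ℝ) (b₁ b₂ : ℝ)
    (hA1 : NoiseAssumption P W)
    (hA2 : FactorAssumption P W G x₀ X)
    (hA3 : PortfolioAssumption P W X U F V₀ V)
    (hA4 : GrowthAssumption P W G F ω a₁ a₂ b₁ b₂)
    (hA5 : MinorizationAssumption P W G ω) :
    ∃ γ₀ : ℝ, γ₀ < 0 ∧ ∃ β L : ℝ≥0 → Set.Ioo (0 : ℝ) 1, ∀ γ ∈ Set.Ioo γ₀ 0,
      -- the Bellman operator maps `C_ω` into itself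
      (∀ f, MemCω ω f → ∃ g, MemCω ω g ∧ ∀ x, bellmanOp P W G F γ f x = (g x : EReal)) ∧
      -- it is a local contraction for the weighted span seminorms
      (∀ (M : ℝ≥0) (f₁ f₂ g₁ g₂ : Vec k → ℝ), MemCω ω f₁ → MemCω ω f₂ →
        (∀ x, bellmanOp P W G F γ f₁ x = (g₁ x : EReal)) →
        (∀ x, bellmanOp P W G F γ f₂ x = (g₂ x : EReal)) →
        spanSeminorm 1 ω f₁ ≤ M → spanSeminorm 1 ω f₂ ≤ M →
        spanSeminorm (β M) ω (g₁ - g₂) ≤ (L M : ℝ) * spanSeminorm (β M) ω (f₁ - f₂)) ∧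
      -- the Bellman equation has a solution, unique up to an additive constant in `u`
      ∃ (u : Vec k → ℝ) (lam : ℝ), MemCω ω u ∧
        (∀ x, ((u x + lam * γ : ℝ) : EReal) = bellmanOp P W G F γ u x) ∧
        ∀ (u' : Vec k → ℝ) (lam' : ℝ), MemCω ω u' →
          (∀ x, ((u' x + lam' * γ : ℝ) : EReal) = bellmanOp P W G F γ u' x) →
          lam' = lam ∧ ∃ c : ℝ, ∀ x, u' x = u x + c := by
  have : CompactSpace U := isCompact_iff_compactSpace.1 hU
  have : Nonempty U := hU_ne.to_subtype
  have S := hA4.controlledModel (hA1.measurable 0) hA2.measurable_G hA2.continuous_G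
    hA3.measurable_F hA3.continuous_F hA5
  have hω := S.nonneg_ω
  set T : ℝ → (Vec k → ℝ) → Vec k → ℝ :=
    bellmanValue P (fun x ξ => G x (W 0 ξ)) (fun x (h : U) ξ => F x h (W 0 ξ)) with hT_def
  choose β L hβ hL hcontr using fun M : ℝ≥0 => S.exists_local_contraction M.coe_nonneg
  -- The contraction constants are fixed before `γ`; the range of `γ` is then tuned to those for `M
  -- = 1`.
  obtain ⟨r, hr0, hr1, hr⟩ := S.exists_forall_oscLE_bellmanValue_zero (hβ 1).1
    (sub_pos.2 (hL 1).2)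
  refine ⟨-r, by linarith, fun M => ⟨β M, hβ M⟩, fun M => ⟨L M, hL M⟩, ?_⟩
  intro γ hγ
  have hγr : |γ| ≤ r := abs_le.2 ⟨hγ.1.le, hγ.2.le.trans hr0.le⟩
  have hγ1 : |γ| ≤ 1 := hγr.trans hr1
  have hop : ∀ {f g : Vec k → ℝ}, MemCω ω f → (∀ x, bellmanOp P W G F γ f x = (g x : EReal)) →
      g = T γ f := fun {f g} hf hg => by
    ext x
    have h := hg x
    rw [bellmanOp_eq_bellmanValue S hγ1 hf] at h
    exact (EReal.coe_injective h).symm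
  have hloc : ∀ (M : ℝ≥0) (f₁ f₂ g₁ g₂ : Vec k → ℝ), MemCω ω f₁ → MemCω ω f₂ →
      (∀ x, bellmanOp P W G F γ f₁ x = (g₁ x : EReal)) →
      (∀ x, bellmanOp P W G F γ f₂ x = (g₂ x : EReal)) →
      spanSeminorm 1 ω f₁ ≤ M → spanSeminorm 1 ω f₂ ≤ M →
      OscLE ω (β M) (L M * spanSeminorm (β M) ω (f₁ - f₂)) (g₁ - g₂) := by
    intro M f₁ f₂ g₁ g₂ hf₁ hf₂ hg₁ hg₂ hM₁ hM₂
    rw [hop hf₁ hg₁, hop hf₂ hg₂]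
    have hsub := hf₁.sub hω hf₂
    exact hcontr M γ f₁ f₂ hγ1 hf₁.1 hf₂.1
      ((hf₁.oscLE_spanSeminorm hω one_pos).mono hω zero_le_one hM₁)
      ((hf₂.oscLE_spanSeminorm hω one_pos).mono hω zero_le_one hM₂) _
      (hsub.spanSeminorm_nonneg hω (hβ M).1) (hsub.oscLE_spanSeminorm hω (hβ M).1)
  refine ⟨fun f hf => ⟨T γ f, memCω_bellmanValue S hγ1 hf,
    bellmanOp_eq_bellmanValue S hγ1 hf⟩, fun M f₁ f₂ g₁ g₂ hf₁ hf₂ hg₁ hg₂ hM₁ hM₂ =>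
    spanSeminorm_le hω (hβ M).1 (hloc M f₁ f₂ g₁ g₂ hf₁ hf₂ hg₁ hg₂ hM₁ hM₂), ?_⟩
  obtain ⟨u, c, huc, huo, hfix⟩ := S.exists_bellman_fixedPoint hγ1 (hβ 1) (hL 1)
    (fun f₁ f₂ => by simpa using hcontr 1 γ f₁ f₂ hγ1) (hr γ hγr)
  have huω : MemCω ω u := by
    obtain ⟨s, hs⟩ := huo.exists_center
    refine memCω_of_bound hω huc (K := 1 + |s|) fun x => ?_
    have h1 : |u x| ≤ |u x - s| + |s| := by simpa using abs_add_le (u x - s) s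
    have h2 := mul_nonneg (abs_nonneg s) (hω x)
    linarith [hs x]
  have hγ0 : γ ≠ 0 := hγ.2.ne
  have hu : ∀ x, ((u x + c / γ * γ : ℝ) : EReal) = bellmanOp P W G F γ u x := fun x => by
    rw [bellmanOp_eq_bellmanValue S hγ1 huω, ← hfix x, div_mul_cancel₀ _ hγ0]
  refine ⟨u, c / γ, huω, hu, fun u' lam' hu'ω hu' => ?_⟩
  set M : ℝ≥0 := (spanSeminorm 1 ω u' ⊔ spanSeminorm 1 ω u).toNNReal with hM
  have hle := hloc M u' u (fun x => u' x + lam' * γ) (fun x => u x + c / γ * γ) hu'ω huω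
    (fun x => (hu' x).symm) (fun x => (hu x).symm)
    ((le_max_left _ _).trans (Real.le_coe_toNNReal _)) ((le_max_right _ _).trans (Real.le_coe_toNNReal _))
  set D := spanSeminorm (β M) ω (u' - u) with hD
  -- The constants `lam' * γ` and `c` drop out of increments, so the contraction compares `u' - u`
  -- with itself.
  have hDle : D ≤ L M * D := spanSeminorm_le hω (hβ M).1 fun x y => by
    have := hle x y
    simp only [Pi.sub_apply] at this ⊢
    linarith
  have hD0 : D ≤ 0 := by nlinarith [(hL M).2]
  have hosc := ((hu'ω.sub hω huω).oscLE_spanSeminorm hω (hβ M).1).mono hω (hβ M).1.le hD0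
  have hconst : ∀ x, u' x = u x + (u' 0 - u 0) := fun x => by
    have h1 := hosc x 0
    have h2 := hosc 0 x
    simp only [Pi.sub_apply] at h1 h2
    linarith
  refine ⟨?_, _, hconst⟩
  obtain ⟨K, hK0, hK⟩ := huω.exists_bound hω
  have h1 := congrFun (hop hu'ω fun x => (hu' x).symm) 0
  -- As `u'` is a translate of `u`, its image is the same translate of the image of `u`, which
  -- identifies the eigenvalues.
  have h2 := S.bellmanValue_add_const hγ1 hK0 huc.measurable hK (u' 0 - u 0) 0
  rw [← funext hconst, ← hfix 0] at h2
  have h3 : lam' * γ = c := by linarith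
  rw [eq_div_iff hγ0, h3]
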